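/- **Setting.** Let $\mathcal D(\mathbb R^3)$ be the space of smooth compactly supported vector fields $f:\mathbb R^3\to\mathbb R^3$, with $\langle f,g\rangle=\int f(x)\cdot g(x)\,dx$. For open $O\subset\mathbb R^3$ let $\mathfrak W(O)$ be the $C^*$-algebra generated by the Weyl operators $e^{iA(f)},e^{iE(g)}$ with $f,g\in\mathcal D(\mathbb R^3)$ supported in $O$. These operators form unitary representations of the additive group $\mathcal D(\mathbb R^3)$ and satisfy $$e^{iA(f)}e^{iE(g)}=e^{i\langle f,g\rangle}e^{iE(g)}e^{iA(f)} .$$ Let $\mathfrak A(O)$ be the gauge invariant part of $\mathfrak W(O)$, i.e. the set of its elements commuting with $e^{iE(\operatorname{grad}s)}$ for all scalar test functions $s$. Put $e^{i\operatorname{div}E(s)}:=e^{-iE(\operatorname{grad}s)}$. Let $q\in\mathbb R$ and let $\gamma:[0,1]\to\mathbb R^3$ be a smooth injective path from $x_1$ to $x_2$ such that $|\gamma(u)-x_k|\ge R\,u(1-u)$ for $0<u<1$, $k=1,2$, and some $R>0$. Let $s_0$ be a scalar test function supported in the open ball of radius $R$ about $0$ with $\int s_0=q$. Put $\gamma_y(u)=\gamma(u)+u(1-u)y$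 and $$b_\varepsilon(x)=\int_\varepsilon^{1-\varepsilon}\!du\int dy\,s_0(y)\,\delta(x-\gamma_y(u))\,\dot\gamma_y(u)\qquad(\varepsilon>0),$$ which are test functions. The *gauge bridge* $\beta=\beta_{q,x_1x_2}$ is the pointwise norm limit on $\mathfrak A(\mathbb R^3)$ $$\beta(A)=\lim_{\varepsilon\searrow0}e^{iA(b_\varepsilon)}\,A\,e^{-iA(b_\varepsilon)} .$$ Let $\omega_\emptyset$ be a state on $\mathfrak A(\mathbb R^3)$ with $\omega_\emptyset(e^{i\operatorname{div}E(s)})=1$ for all scalar test functions $s$. Put $\mathscr X=\{x_1,x_2\}$. A *closed surface* is the boundary $\sigma=\partial\tau$ of a region $\tau$, where $\tau$ is the union of the images of finitely many smooth maps $[0,1]^3\to\mathbb R^3$ that are injective and orientation preserving on the open cube and whose images of the open cube are pairwise disjoint. It *encloses* $x$ if $x$ is an interior point of $\tau$. For a scalar test function $s$ with $\int s=1$, the surface function is $g_\sigma(x)=\int_\sigma s(x-y)\,n(y)\,d\sigma(y)$, with $n$ the outward unit normal. **Statement.** The limit $\beta$ exists and is an automorphism of $\mathfrak A(\mathbb R^3)$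 which maps $\mathfrak A(\mathbb R^3\setminus\mathscr X)$ onto itself. The functional $\omega_{\mathscr X}:=\omega_\emptyset\circ\beta$ on $\mathfrak A(\mathbb R^3\setminus\mathscr X)$ is a state, and: (i) $\omega_{\mathscr X}(e^{i\operatorname{div}E(s)})=1$ for all scalar test functions $s$ supported in $\mathbb R^3\setminus\mathscr X$. (ii) For every closed surface $\sigma\subset\mathbb R^3\setminus\mathscr X$ there is $\delta>0$ such that, for every scalar test function $s$ with $\int s=1$ and support in the ball of radius $\delta$ about $0$, the surface function $g_\sigma$ is supported in $\mathbb R^3\setminus\mathscr X$ and $$\omega_{\mathscr X}(e^{iE(g_\sigma)})=\begin{cases}1&\text{if }\sigma\text{ encloses none or both of }x_1,x_2,\\ e^{iq}&\text{if }\sigma\text{ encloses only }x_1,\\ e^{-iq}&\text{if }\sigma\text{ encloses only }x_2.\end{cases}$$ (iii) Let $O$ be an open set whose closure is compact, contained in $\mathbb R^3\setminus\mathscr X$, and contractible to a point within $\mathbb R^3\setminus\mathscr X$ (that is, the inclusion $\overline O\hookrightarrow\mathbb R^3\setminus\mathscr X$ is null-homotopic; for instance, $\overline O$ is contractible, or $\overline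 O$ lies in a contractible subset of $\mathbb R^3\setminus\mathscr X$). Then the restriction $\omega_{\mathscr X}\upharpoonright\mathfrak A(O)$ is a vector state in the GNS representation $(\pi,\mathcal H)$ of $\omega_\emptyset$: there is a unit vector $\Psi\in\mathcal H$ with $\omega_{\mathscr X}(A)=\langle\Psi,\pi(A)\Psi\rangle$ for all $A\in\mathfrak A(O)$. -/

import Mathlib

open Set Filter Topology MeasureTheory TopologicalSpace
open scoped ContDiff Distributions ComplexOrder

noncomputable section

namespace StaticCharges

/-- Physical space `ℝ³` with its Euclidean structure. -/
abbrev E3 : Type := EuclideanSpace ℝ (Fin 3)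

/-- Real scalar test functions on `ℝ³`. -/
abbrev ScalarTest : Type := 𝓓((⊤ : Opens E3), ℝ)

/-- Real vector-valued test functions on `ℝ³`. -/
abbrev VectorTest : Type := 𝓓((⊤ : Opens E3), E3)

/-! ### Two facts on integrals depending on a parameter

They are only used to see that the mollified integrals below are test functions. -/

theorem contDiff_integral_of_compact {T P : Type} {E F : Type}
    [TopologicalSpace T] [CompactSpace T] [MeasurableSpace T] [BorelSpace T]
    [NormedAddCommGroup P] [NormedSpace ℝ P]
    [NormedAddCommGroup E] [NormedSpace ℝ E] [ProperSpace E]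
    [NormedAddCommGroup F] [NormedSpace ℝ F]
    (μ : Measure T) [IsFiniteMeasure μ] (p : T → P) (hp : Continuous p)
    (Φ : P × E → F) (hΦ : ContDiff ℝ ∞ Φ) :
    ContDiff ℝ ∞ (fun x => ∫ t, Φ (p t, x) ∂μ) := by
  rw [contDiff_infty]
  intro n
  have hint : ∀ {G : Type} [NormedAddCommGroup G] [NormedSpace ℝ G] (h : T → G),
      Continuous h → Integrable h μ := by
    intro G _ _ h hh
    exact hh.integrable_of_hasCompactSupport (HasCompactSupport.of_compactSpace h)
  have key : ∀ {G : Type} [NormedAddCommGroup G] [NormedSpace ℝ G] (Ψ : P × E → G),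
      ContDiff ℝ ∞ Ψ → ∀ x, HasFDerivAt (fun x => ∫ t, Ψ (p t, x) ∂μ)
        (∫ t, (fderiv ℝ Ψ (p t, x)).comp (ContinuousLinearMap.inr ℝ P E) ∂μ) x := by
    intro G _ _ Ψ hΨ x
    have hc : Continuous (fun z : T × E =>
        (fderiv ℝ Ψ (p z.1, z.2)).comp (ContinuousLinearMap.inr ℝ P E)) := by
      have h1 : Continuous (fderiv ℝ Ψ) := hΨ.continuous_fderiv (by simp)
      exact (h1.comp ((hp.comp continuous_fst).prodMk continuous_snd)).clm_comp continuous_const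
    obtain ⟨C, hC⟩ := ((isCompact_univ (X := T)).prod
      (isCompact_closedBall x 1)).exists_bound_of_continuousOn hc.continuousOn
    refine hasFDerivAt_integral_of_dominated_of_fderiv_le (bound := fun _ => C)
      (Metric.closedBall_mem_nhds x one_pos)
      (Eventually.of_forall fun y => (hint _ ?_).aestronglyMeasurable)
      (hint _ ?_) (hint _ ?_).aestronglyMeasurable
      (Eventually.of_forall fun t y hy => hC (t, y) ⟨mem_univ _, hy⟩) (integrable_const _)
      (Eventually.of_forall fun t y _ => ?_)
    · exact hΨ.continuous.comp (hp.prodMk continuous_const)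
    · exact hΨ.continuous.comp (hp.prodMk continuous_const)
    · exact hc.comp (continuous_id.prodMk continuous_const)
    · have h2 : HasFDerivAt Ψ (fderiv ℝ Ψ (p t, y)) (p t, y) :=
        (hΨ.differentiable (by simp) _).hasFDerivAt
      exact h2.comp y (hasFDerivAt_prodMk_right (p t) y)
  induction n generalizing F with
  | zero =>
    rw [Nat.cast_zero, contDiff_zero]
    exact continuous_iff_continuousAt.2 fun x => (key Φ hΦ x).continuousAt
  | succ n ih =>
    rw [Nat.cast_succ, contDiff_succ_iff_hasFDerivAt]
    refine ⟨_, ih (fun z => (fderiv ℝ Φ z).comp (ContinuousLinearMap.inr ℝ P E)) ?_, key Φ hΦ⟩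
    exact (hΦ.fderiv_right (m := ∞) (by simp)).clm_comp contDiff_const

theorem contDiff_setIntegral_of_compact {T P : Type} {E F : Type}
    [TopologicalSpace T] [T2Space T] [MeasurableSpace T] [BorelSpace T]
    [NormedAddCommGroup P] [NormedSpace ℝ P]
    [NormedAddCommGroup E] [NormedSpace ℝ E] [ProperSpace E]
    [NormedAddCommGroup F] [NormedSpace ℝ F]
    (μ : Measure T) [IsFiniteMeasureOnCompacts μ] {K : Set T} (hK : IsCompact K)
    (p : T → P) (hp : ContinuousOn p K) (Φ : P × E → F) (hΦ : ContDiff ℝ ∞ Φ) :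
    ContDiff ℝ ∞ (fun x => ∫ t in K, Φ (p t, x) ∂μ) := by
  have : CompactSpace K := isCompact_iff_compactSpace.1 hK
  have hfin : IsFiniteMeasure (Measure.comap (Subtype.val : K → T) μ) := by
    refine ⟨?_⟩
    rw [(MeasurableEmbedding.subtype_coe hK.measurableSet).comap_apply]
    simpa using hK.measure_lt_top
  have h := contDiff_integral_of_compact (Measure.comap (Subtype.val : K → T) μ)
    (fun t => p t) (continuousOn_iff_continuous_domRestrict.1 hp) Φ hΦ
  have he : (fun x => ∫ t in K, Φ (p t, x) ∂μ) =
      fun x => ∫ t : K, Φ (p t, x) ∂Measure.comap (Subtype.val : K → T) μ :=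
    funext fun x => (integral_subtype_comap hK.measurableSet (fun t => Φ (p t, x))).symm
  rw [he]
  exact h

/-! ### Test functions: pairing and gradient -/

/-- `⟨f, g⟩ = ∫ f(x) · g(x) dx`. -/
def pairing (f g : VectorTest) : ℝ := ∫ x, inner ℝ (f x) (g x)

theorem integrable_inner (f g : VectorTest) : Integrable (fun x => inner ℝ (f x) (g x)) := by
  refine Continuous.integrable_of_hasCompactSupport (f.continuous.inner g.continuous) ?_
  exact f.hasCompactSupport.mono fun x hx h => hx (by simp [h])

theorem pairing_sub_left (f f' g : VectorTest) :
    pairing (f - f') g = pairing f g - pairing f' g := by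
  unfold pairing
  rw [← integral_sub (integrable_inner f g) (integrable_inner f' g)]
  exact integral_congr_ae (Eventually.of_forall fun x => inner_sub_left (f x) (f' x) (g x))

theorem pairing_neg_right (f g : VectorTest) : pairing f (-g) = -pairing f g := by
  unfold pairing
  rw [← integral_neg]
  exact integral_congr_ae (Eventually.of_forall fun x => inner_neg_right (f x) (g x))

theorem contDiff_gradient (s : ScalarTest) : ContDiff ℝ ∞ (gradient (s : E3 → ℝ)) :=
  (InnerProductSpace.toDual ℝ E3).symm.toContinuousLinearEquiv.contDiff.comp
    (s.contDiff.fderiv_right (m := ∞) (by simp))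

theorem tsupport_gradient_subset (s : ScalarTest) :
    tsupport (gradient (s : E3 → ℝ)) ⊆ tsupport s := by
  refine closure_minimal (fun x hx => ?_) (isClosed_tsupport _)
  refine support_fderiv_subset ℝ fun h => hx ?_
  simp [gradient, h]

/-- The gradient of a scalar test function. -/
def grad (s : ScalarTest) : VectorTest where
  toFun := gradient (s : E3 → ℝ)
  contDiff' := contDiff_gradient s
  hasCompactSupport' := s.hasCompactSupport.of_isClosed_subset (isClosed_tsupport _)
    (tsupport_gradient_subset s)
  tsupport_subset' := fun _ _ => trivial

/-! ### The Weyl algebra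

The Weyl relations with the nondegenerate form `⟨·,·⟩` have, up to isomorphism, one C*-algebra
generated by nonzero operators satisfying them. It is realised here in the (twisted) regular
representation on `ℓ²` of the group `𝓓(ℝ³) × 𝓓(ℝ³)`. -/

/-- The Hilbert space of the regular representation. -/
abbrev WeylSpace : Type := lp (fun _ : VectorTest × VectorTest => ℂ) 2

/-- `(T ψ)(i) = c(i) ψ(e(i))` for a bijection `e` of the index set and phases `c`. -/
def phaseShift {ι : Type} (e : ι ≃ ι) (c : ι → Circle) :
    lp (fun _ : ι => ℂ) 2 →ₗᵢ[ℂ] lp (fun _ : ι => ℂ) 2 where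
  toFun ψ := ⟨fun i => (c i : ℂ) * ψ (e i), by
    refine memℓp_gen ?_
    have h := (e.summable_iff (f := fun i => ‖ψ i‖ ^ (2 : ENNReal).toReal)).2
      ((lp.memℓp ψ).summable (by simp))
    simpa [Function.comp_def, Circle.norm_coe] using h⟩
  map_add' ψ φ := by
    ext i
    exact mul_add _ _ _
  map_smul' a ψ := by
    ext i
    simp [mul_left_comm]
  norm_map' ψ := by
    rw [lp.norm_eq_tsum_rpow (by simp), lp.norm_eq_tsum_rpow (by simp)]
    congr 1
    rw [← e.tsum_eq (fun i => ‖ψ i‖ ^ (2 : ENNReal).toReal)]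
    simp [Circle.norm_coe]

/-- Bounded operators on the Hilbert space of the regular representation. -/
abbrev Op : Type := WeylSpace →L[ℂ] WeylSpace

/-- The Weyl operator `e^{iA(f)}`: `(e^{iA(f)} ψ)(f', g') = ψ(f' - f, g')`. -/
def expA (f : VectorTest) : Op :=
  (phaseShift ((Equiv.subRight f).prodCongr (Equiv.refl VectorTest))
    (fun _ => 1)).toContinuousLinearMap

/-- The Weyl operator `e^{iE(g)}`: `(e^{iE(g)} ψ)(f', g') = e^{-i⟨f', g⟩} ψ(f', g' - g)`. -/
def expE (g : VectorTest) : Op :=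
  (phaseShift ((Equiv.refl VectorTest).prodCongr (Equiv.subRight g))
    (fun i => Circle.exp (-pairing i.1 g))).toContinuousLinearMap

theorem expA_apply (f : VectorTest) (ψ : WeylSpace) (i : VectorTest × VectorTest) :
    expA f ψ i = ψ (i.1 - f, i.2) := by
  simp [expA, phaseShift, Prod.map]

theorem expE_apply (g : VectorTest) (ψ : WeylSpace) (i : VectorTest × VectorTest) :
    expE g ψ i = (Circle.exp (-pairing i.1 g) : ℂ) * ψ (i.1, i.2 - g) := by
  simp [expE, phaseShift, Prod.map]

/-- The Weyl relations `e^{iA(f)} e^{iE(g)} = e^{i⟨f,g⟩} e^{iE(g)} e^{iA(f)}`. -/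
theorem weyl_relation (f g : VectorTest) :
    expA f * expE g = Complex.exp (Complex.I * pairing f g) • (expE g * expA f) := by
  ext ψ i
  simp only [mul_apply_eq_comp, smul_apply, lp.coeFn_smul,
    Pi.smul_apply, smul_eq_mul, expA_apply, expE_apply, Circle.coe_exp, ← mul_assoc]
  rw [← Complex.exp_add, pairing_sub_left]
  congr 2
  push_cast
  ring

theorem expE_comm (g g' : VectorTest) : expE g * expE g' = expE g' * expE g := by
  ext ψ i
  simp only [mul_apply_eq_comp, expE_apply]
  rw [sub_right_comm]
  ring

theorem expE_mul_neg (g : VectorTest) : expE g * expE (-g) = 1 := by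
  ext ψ i
  simp only [mul_apply_eq_comp, expE_apply, pairing_neg_right, Circle.coe_exp,
    ← mul_assoc, one_apply_eq_self]
  rw [← Complex.exp_add]
  simp

theorem star_expE (g : VectorTest) : star (expE g) = expE (-g) := by
  have h : star (expE g) * expE g = 1 :=
    (ContinuousLinearMap.norm_map_iff_adjoint_comp_self (expE g)).1
      (LinearIsometry.norm_map (phaseShift _ _))
  calc star (expE g) = star (expE g) * (expE g * expE (-g)) := by rw [expE_mul_neg, mul_one]
    _ = expE (-g) := by rw [← mul_assoc, h, one_mul]

/-- The local Weyl algebra `𝔚(O)`: the C*-algebra generated by the operators `e^{iA(f)}`,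
`e^{iE(g)}` with `f, g` supported in `O`. -/
def weylAlgebra (O : Opens E3) : StarSubalgebra ℂ Op :=
  (StarAlgebra.adjoin ℂ ({W | ∃ f : VectorTest, tsupport f ⊆ O ∧ W = expA f} ∪
    {W | ∃ g : VectorTest, tsupport g ⊆ O ∧ W = expE g})).topologicalClosure

/-- The local algebra of observables `𝔄(O)`: the gauge invariant part of `𝔚(O)`, that is the set of
its elements commuting with all operators `e^{iE(grad s)}`. -/
def observables (O : Opens E3) : StarSubalgebra ℂ Op :=
  weylAlgebra O ⊓ StarSubalgebra.centralizer ℂ {W | ∃ s : ScalarTest, W = expE (grad s)}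

theorem observables_mono {O O' : Opens E3} (h : O ≤ O') : observables O ≤ observables O' := by
  refine inf_le_inf_right _ (StarSubalgebra.topologicalClosure_mono (StarAlgebra.adjoin_mono ?_))
  refine union_subset_union ?_ ?_
  · rintro W ⟨f, hf, rfl⟩
    exact ⟨f, hf.trans h, rfl⟩
  · rintro W ⟨f, hf, rfl⟩
    exact ⟨f, hf.trans h, rfl⟩

theorem isClosed_observables (O : Opens E3) : IsClosed (observables O : Set Op) :=
  (StarSubalgebra.isClosed_topologicalClosure _).inter (Set.isClosed_centralizer _)

instance (O : Opens E3) : CompleteSpace (observables O) :=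
  (isClosed_observables O).completeSpace_coe

instance (O : Opens E3) : CStarAlgebra (observables O) where

/-- The usual order of a C*-algebra: `0 ≤ a` iff `a` is of the form `b⋆ b`. -/
instance (O : Opens E3) : PartialOrder (observables O) := CStarAlgebra.spectralOrder _

instance (O : Opens E3) : StarOrderedRing (observables O) := CStarAlgebra.spectralOrderedRing _

theorem expE_mem (O : Opens E3) (g : VectorTest) (hg : tsupport g ⊆ O) :
    expE g ∈ observables O := by
  refine ⟨StarSubalgebra.le_topologicalClosure _
    (StarAlgebra.subset_adjoin ℂ _ (Or.inr ⟨g, hg, rfl⟩)), ?_⟩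
  refine (StarSubalgebra.mem_centralizer_iff ℂ).2 ?_
  rintro W ⟨s, rfl⟩
  rw [star_expE]
  exact ⟨expE_comm _ _, expE_comm _ _⟩

/-- `e^{iE(g)}` as an element of `𝔄(O)`, for `g` supported in `O`. -/
def fieldE (O : Opens E3) (g : VectorTest) (hg : tsupport g ⊆ O) : observables O :=
  ⟨expE g, expE_mem O g hg⟩

theorem tsupport_neg_grad_subset (s : ScalarTest) {O : Set E3} (hs : tsupport s ⊆ O) :
    tsupport (-grad s : VectorTest) ⊆ O := by
  have h : ((-grad s : VectorTest) : E3 → E3) = -(gradient (s : E3 → ℝ)) := rfl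
  rw [h, tsupport_neg]
  exact (tsupport_gradient_subset s).trans hs

/-- `e^{i div E(s)} = e^{-iE(grad s)}` as an element of `𝔄(O)`, for `s` supported in `O`. -/
def chargeDensity (O : Opens E3) (s : ScalarTest) (hs : tsupport s ⊆ O) : observables O :=
  fieldE O (-grad s) (tsupport_neg_grad_subset s hs)

/-! ### Gauge bridges -/

/-- The data from which a gauge bridge between `x₁` and `x₂` with charge `q` is built: a smooth
simple path `γ` from `x₁` to `x₂`, which stays away from its end points in the quantitative sense
`|γ(u) - xₖ| ≥ R u (1 - u)`, and a scalar test function `s` of integral `q`, supported in the ball of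
radius `R`. -/
structure BridgeData (x₁ x₂ : E3) (q : ℝ) where
  path : ℝ → E3
  smooth : ContDiffOn ℝ ∞ path (Icc 0 1)
  simple : InjOn path (Icc 0 1)
  source : path 0 = x₁
  target : path 1 = x₂
  R : ℝ
  R_pos : 0 < R
  away_left : ∀ u ∈ Ioo (0 : ℝ) 1, R ≤ u⁻¹ * (1 - u)⁻¹ * ‖path u - x₁‖
  away_right : ∀ u ∈ Ioo (0 : ℝ) 1, R ≤ u⁻¹ * (1 - u)⁻¹ * ‖path u - x₂‖
  profile : ScalarTest
  profile_support : tsupport profile ⊆ Metric.ball 0 R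
  profile_integral : ∫ y, profile y = q

namespace BridgeData

variable {x₁ x₂ : E3} {q : ℝ} (D : BridgeData x₁ x₂ q)

/-- The neighbouring path `γ_y(u) = γ(u) + u (1 - u) y`. -/
def pathAt (y : E3) (u : ℝ) : E3 := D.path u + (u * (1 - u)) • y

/-- Its velocity `γ_y'(u) = γ'(u) + (1 - 2u) y`. -/
def velocityAt (y : E3) (u : ℝ) : E3 := derivWithin D.path (Icc 0 1) u + (1 - 2 * u) • y

/-- The vector field `a_u(x) = ∫ s(y) δ(x - γ_y(u)) γ_y'(u) dy`, for `0 < u < 1`. The substitution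
`z = γ_y(u)`, of Jacobian `(u (1 - u))³`, evaluates the Dirac measure at `y = (x - γ(u))/(u (1 - u))`
(see `integral_inner_slice`). -/
def slice (u : ℝ) (x : E3) : E3 :=
  (((u * (1 - u))⁻¹) ^ 3 * D.profile ((u * (1 - u))⁻¹ • (x - D.path u))) •
    D.velocityAt ((u * (1 - u))⁻¹ • (x - D.path u)) u

theorem integral_inner_slice {u : ℝ} (hu : u ∈ Ioo (0 : ℝ) 1) (g : VectorTest) :
    ∫ x, inner ℝ (D.slice u x) (g x) =
      ∫ y, D.profile y * inner ℝ (D.velocityAt y u) (g (D.pathAt y u)) := by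
  have hk : 0 < u * (1 - u) := mul_pos hu.1 (sub_pos.2 hu.2)
  rw [← integral_add_right_eq_self _ (D.path u)]
  have h := Measure.integral_comp_inv_smul_of_nonneg (volume : Measure E3)
    (fun y => ((u * (1 - u))⁻¹) ^ 3 *
      (D.profile y * inner ℝ (D.velocityAt y u) (g (D.pathAt y u)))) hk.le
  rw [integral_const_mul (_ ^ 3) (fun y => D.profile y * _), finrank_euclideanSpace_fin,
    smul_eq_mul, ← mul_assoc (_ ^ 3), ← mul_pow, mul_inv_cancel₀ hk.ne', one_pow, one_mul] at h
  rw [← h]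
  refine integral_congr_ae (Eventually.of_forall fun x => ?_)
  simp only [slice, pathAt, add_sub_cancel_right, inner_smul_left, smul_smul,
    mul_inv_cancel₀ hk.ne', one_smul]
  simp [mul_assoc, add_comm]

/-- `b_ε(x) = ∫_ε^{1-ε} a_u(x) du`. -/
def cutoffFun (ε : ℝ) (x : E3) : E3 := ∫ u in Icc ε (1 - ε), D.slice u x

theorem continuousOn_derivWithin : ContinuousOn (derivWithin D.path (Icc 0 1)) (Icc 0 1) :=
  D.smooth.continuousOn_derivWithin (uniqueDiffOn_Icc one_pos) (by simp)

theorem contDiff_cutoffFun {ε : ℝ} (hε : 0 < ε) : ContDiff ℝ ∞ (D.cutoffFun ε) := by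
  have hsub : Icc ε (1 - ε) ⊆ Icc 0 1 := Icc_subset_Icc hε.le (by linarith)
  have hk : ∀ u ∈ Icc ε (1 - ε), u * (1 - u) ≠ 0 := fun u hu =>
    (mul_pos (hε.trans_le hu.1) (by linarith [hu.2])).ne'
  have hp : ContinuousOn (fun u : ℝ => (((u * (1 - u))⁻¹, 1 - 2 * u),
      (D.path u, derivWithin D.path (Icc 0 1) u))) (Icc ε (1 - ε)) := by
    refine ContinuousOn.prodMk (ContinuousOn.prodMk ?_ ?_) (ContinuousOn.prodMk ?_ ?_)
    · exact ContinuousOn.inv₀ (by fun_prop) hk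
    · fun_prop
    · exact D.smooth.continuousOn.mono hsub
    · exact D.continuousOn_derivWithin.mono hsub
  have hs : ContDiff ℝ ∞ (D.profile : E3 → ℝ) := D.profile.contDiff
  refine contDiff_setIntegral_of_compact volume isCompact_Icc _ hp
    (fun z : ((ℝ × ℝ) × (E3 × E3)) × E3 =>
      ((z.1.1.1) ^ 3 * D.profile (z.1.1.1 • (z.2 - z.1.2.1))) •
        (z.1.2.2 + z.1.1.2 • (z.1.1.1 • (z.2 - z.1.2.1)))) ?_
  fun_prop

theorem hasCompactSupport_cutoffFun {ε : ℝ} (hε : 0 < ε) :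
    HasCompactSupport (D.cutoffFun ε) := by
  have hsub : Icc ε (1 - ε) ⊆ Icc 0 1 := Icc_subset_Icc hε.le (by linarith)
  have hc : IsCompact ((fun z : ℝ × E3 => D.pathAt z.2 z.1) ''
      (Icc ε (1 - ε) ×ˢ tsupport D.profile)) := by
    refine (isCompact_Icc.prod D.profile.hasCompactSupport).image_of_continuousOn ?_
    refine ContinuousOn.add ?_ (by fun_prop)
    exact (D.smooth.continuousOn.mono hsub).comp continuousOn_fst fun z hz => hz.1
  refine HasCompactSupport.of_support_subset_isCompact hc fun x hx => ?_
  by_contra hn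
  refine hx (setIntegral_eq_zero_of_forall_eq_zero fun u hu => ?_)
  have hk : u * (1 - u) ≠ 0 := (mul_pos (hε.trans_le hu.1) (by linarith [hu.2])).ne'
  have h0 : D.profile ((u * (1 - u))⁻¹ • (x - D.path u)) = 0 := by
    by_contra h
    refine hn ⟨(u, (u * (1 - u))⁻¹ • (x - D.path u)), ⟨hu, subset_tsupport _ h⟩, ?_⟩
    simp only [pathAt, smul_smul, mul_inv_cancel₀ hk, one_smul, add_sub_cancel]
  rw [slice, h0, mul_zero, zero_smul]

/-- The test function `b_ε`, `ε > 0` (the value for `ε ≤ 0` is irrelevant). -/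
def cutoff (ε : ℝ) : VectorTest :=
  if hε : 0 < ε then
    { toFun := D.cutoffFun ε
      contDiff' := D.contDiff_cutoffFun hε
      hasCompactSupport' := D.hasCompactSupport_cutoffFun hε
      tsupport_subset' := fun _ _ => trivial }
  else 0

/-- `β` is the gauge bridge belonging to the given data: the pointwise norm limit, for `ε ↘ 0`, of the
automorphisms `A ↦ e^{iA(b_ε)} A e^{-iA(b_ε)}` on the algebra of observables. -/
def IsGaugeBridge (β : observables ⊤ ≃⋆ₐ[ℂ] observables ⊤) : Prop :=
  ∀ A : observables ⊤, Tendsto (fun ε : ℝ => expA (D.cutoff ε) * (A : Op) * expA (-D.cutoff ε))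
    (𝓝[>] 0) (𝓝 (β A : Op))

end BridgeData

/-- The complement of `{x₁, x₂}`. -/
def awayFrom (x₁ x₂ : E3) : Opens E3 :=
  ⟨({x₁, x₂} : Set E3)ᶜ, (Set.toFinite _).isClosed.isOpen_compl⟩

/-- The inclusion `𝔄(O) ⊆ 𝔄(ℝ³)`. -/
def toGlobal (O : Opens E3) : observables O →⋆ₐ[ℂ] observables ⊤ :=
  StarSubalgebra.inclusion (observables_mono le_top)

/-- The functional `ω_X = ω₀ ∘ β` on `𝔄(ℝ³ ∖ X)`, `X = {x₁, x₂}`. -/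
def chargedState (x₁ x₂ : E3) (ω₀ : observables ⊤ →ₚ[ℂ] ℂ)
    (β : observables ⊤ ≃⋆ₐ[ℂ] observables ⊤) : observables (awayFrom x₁ x₂) →ₚ[ℂ] ℂ :=
  ω₀.comp (PositiveLinearMap.ofClass
    ((β : observables ⊤ →⋆ₐ[ℂ] observables ⊤).comp (toGlobal (awayFrom x₁ x₂))))

/-! ### Closed surfaces -/

/-- The vector product on `ℝ³`. -/
def cross (a b : E3) : E3 := WithLp.toLp 2 (crossProduct (WithLp.ofLp a) (WithLp.ofLp b))

/-- A smooth oriented surface patch `σ : [0,1]² → ℝ³`. -/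
structure Patch where
  toFun : (Fin 2 → ℝ) → E3
  smooth : ContDiffOn ℝ ∞ toFun (Icc 0 1)

namespace Patch

variable (σ : Patch)

/-- The surface normal `n_σ(u) = ∂₁σ(u) × ∂₂σ(u)`, whose length is the density of the surface
measure. -/
def normal (u : Fin 2 → ℝ) : E3 :=
  cross (fderivWithin ℝ σ.toFun (Icc 0 1) u (Pi.single 0 1))
    (fderivWithin ℝ σ.toFun (Icc 0 1) u (Pi.single 1 1))

theorem continuousOn_normal : ContinuousOn σ.normal (Icc 0 1) := by
  have hu : UniqueDiffOn ℝ (Icc (0 : Fin 2 → ℝ) 1) := by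
    rw [← Set.pi_univ_Icc]
    exact UniqueDiffOn.univ_pi fun _ => uniqueDiffOn_Icc one_pos
  have h := σ.smooth.continuousOn_fderivWithin hu (by simp)
  have h0 := h.clm_apply (continuousOn_const (c := (Pi.single 0 1 : Fin 2 → ℝ)))
  have h1 := h.clm_apply (continuousOn_const (c := (Pi.single 1 1 : Fin 2 → ℝ)))
  have hc : Continuous (fun z : E3 × E3 => cross z.1 z.2) := by
    unfold cross
    simp only [cross_apply]
    refine (PiLp.continuous_toLp 2 _).comp (continuous_pi fun i => ?_)
    fin_cases i <;> simp <;> fun_prop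
  exact hc.comp_continuousOn (h0.prodMk h1)

/-- The mollified surface `g_σ(x) = ∬ s(x - σ(u)) n_σ(u) d²u`. -/
def surfaceFun (s : ScalarTest) : VectorTest where
  toFun x := ∫ u in Icc 0 1, s (x - σ.toFun u) • σ.normal u
  contDiff' := by
    have hs : ContDiff ℝ ∞ (s : E3 → ℝ) := s.contDiff
    refine contDiff_setIntegral_of_compact volume isCompact_Icc
      (fun u => (σ.toFun u, σ.normal u)) (σ.smooth.continuousOn.prodMk σ.continuousOn_normal)
      (fun z : (E3 × E3) × E3 => s (z.2 - z.1.1) • z.1.2) ?_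
    fun_prop
  hasCompactSupport' := by
    have hc : IsCompact ((fun z : (Fin 2 → ℝ) × E3 => σ.toFun z.1 + z.2) ''
        (Icc 0 1 ×ˢ tsupport s)) := by
      refine (isCompact_Icc.prod s.hasCompactSupport).image_of_continuousOn ?_
      exact (σ.smooth.continuousOn.comp continuousOn_fst fun z hz => hz.1).add continuousOn_snd
    refine HasCompactSupport.of_support_subset_isCompact hc fun x hx => ?_
    by_contra hn
    refine hx (setIntegral_eq_zero_of_forall_eq_zero fun u hu => ?_)
    have h0 : s (x - σ.toFun u) = 0 := by
      by_contra h
      exact hn ⟨(u, x - σ.toFun u), ⟨hu, subset_tsupport _ h⟩, by simp⟩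
    simp [h0]
  tsupport_subset' := fun _ _ => trivial

end Patch

/-- The face of the unit cube on which the coordinate `k` is `1` (`top = true`) or `0`
(`top = false`), parametrised by `[0,1]²` so that it is oriented by the outward normal. -/
def face (k : Fin 3) (top : Bool) (u : Fin 2 → ℝ) : Fin 3 → ℝ := fun j =>
  if j = k then (if top then 1 else 0)
  else if j = k + 1 then (if top then u 0 else u 1)
  else (if top then u 1 else u 0)

theorem contDiff_face (k : Fin 3) (top : Bool) : ContDiff ℝ ∞ (face k top) := by
  refine contDiff_pi.2 fun j => ?_
  unfold face
  split_ifs <;> fun_prop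

theorem mapsTo_face (k : Fin 3) (top : Bool) : MapsTo (face k top) (Icc 0 1) (Icc 0 1) := by
  intro u hu
  have h0 := hu.1 0
  have h1 := hu.2 0
  have h2 := hu.1 1
  have h3 := hu.2 1
  constructor <;> intro j <;> simp only [face, Pi.zero_apply, Pi.one_apply] at * <;>
    split_ifs <;> first | assumption | norm_num

/-- A region of `ℝ³` with piecewise smooth boundary, fixed by finitely many smooth maps
`τ : [0,1]³ → ℝ³` of the unit cube, which on the open cube are orientation preserving and
injective, and whose images of the open cube do not overlap. (On the boundary of the cube the maps
may degenerate or be identified, as in spherical coordinates.) -/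
structure Region where
  ι : Type
  [fintype : Fintype ι]
  cell : ι → (Fin 3 → ℝ) → E3
  smooth : ∀ i, ContDiffOn ℝ ∞ (cell i) (Icc 0 1)
  injective : ∀ i j, ∀ u ∈ interior (Icc (0 : Fin 3 → ℝ) 1), ∀ v ∈ interior (Icc (0 : Fin 3 → ℝ) 1),
    cell i u = cell j v → i = j ∧ u = v
  oriented : ∀ i, ∀ u ∈ interior (Icc (0 : Fin 3 → ℝ) 1),
    0 < inner ℝ (fderiv ℝ (cell i) u (Pi.single 0 1))
      (cross (fderiv ℝ (cell i) u (Pi.single 1 1)) (fderiv ℝ (cell i) u (Pi.single 2 1)))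

namespace Region

variable (τ : Region)

instance : Fintype τ.ι := τ.fintype

/-- The points of the region. -/
def carrier : Set E3 := ⋃ i, τ.cell i '' Icc 0 1

/-- The points of the closed surface `σ = ∂τ`. -/
def surface : Set E3 := frontier τ.carrier

/-- The closed surface `σ = ∂τ` encloses `x` if `x` is an interior point of the region. -/
def Encloses (x : E3) : Prop := x ∈ interior τ.carrier

/-- The faces of the cells, oriented outwards. -/
def facePatch (i : τ.ι) (k : Fin 3) (top : Bool) : Patch where
  toFun := τ.cell i ∘ face k top
  smooth := (τ.smooth i).comp (contDiff_face k top).contDiffOn (mapsTo_face k top)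

/-- The surface function `g_σ` of the closed surface `σ = ∂τ`: the sum of the mollified surface
integrals over the outward oriented faces of the cells. Pieces along which cells are glued occur
twice, with opposite orientations, and drop out, so what remains is the integral over `σ`. -/
def surfaceFun (s : ScalarTest) : VectorTest :=
  ∑ i : τ.ι, ∑ k : Fin 3, ∑ top : Bool, (τ.facePatch i k top).surfaceFun s

end Region

end StaticCharges

end

noncomputable section

namespace StaticCharges

/-! ### Automorphisms which fix the `e^{iA(f)}` and multiply the `e^{iE(g)}` by phases -/

/-! Conjugation by $e^{iA(b)}$ fixes every $e^{iA(f)}$ and multiplies $e^{iE(g)}$ by $e^{i\langle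
b,g\rangle}$. Automorphisms are isometric, so the conjugations by $e^{iA(b_\varepsilon)}$ converge
pointwise on the Weyl algebra once the numbers $\langle b_\varepsilon,g\rangle$ converge. They do:
these are integrals over $[\varepsilon,1-\varepsilon]$ of an integrable flux, and they tend to an
additive functional $\ell(g)$ (`fluxFunctional`). In the regular representation the phases
$e^{i\ell(g)}$ are implemented by a multiplication operator, so the limit is the restriction of an
automorphism of all bounded operators, and it preserves each $\mathfrak A(O)$.

If $S$ is constant near $x_1$ and near $x_2$, the fundamental theorem of calculus along each
$\gamma_y$ gives $\ell(\operatorname{grad}S)=q\,(S(x_2)-S(x_1))$ (`fluxFunctional_grad`). Part (i)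
is the case in which $S$ vanishes near both points. For part (ii), the divergence theorem on the
cells gives $g_\sigma=-\operatorname{grad}(1_\tau * s)$ (`Region.surfaceFun_eq`), and the mollified
indicator is $1$ near enclosed points and $0$ near points outside $\tau$.

For part (iii), put $K=\overline O$. On fields supported in $K$ the functional $\ell$ is replaced by
the pairing with a divergence free test function $b$ (`BridgeData.exists_divergenceFree`): the
bridge is cut off close to its ends and its end charges are led back to each other by fields
supported off $K$. Then $e^{iA(b)}$ is an observable, it implements $\beta$ on $\mathfrak A(O)$, and
$e^{-iA(b)}$ yields the vector. The return path exists because $x_1$ and $x_2$ lie in one component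
of $K^c$. Indeed, if $K$ contracts in the complement of $a$, then $a$ lies in the unbounded
component: otherwise a homotopy extension argument produces a continuous map of space which is the
identity far out and omits $a$. Such a map is onto, by a degree argument carried out with the
divergence theorem (`surjective_of_continuous_of_eq_id`). -/

theorem pairing_add_left (f f' g : VectorTest) :
    pairing (f + f') g = pairing f g + pairing f' g := by
  unfold pairing
  rw [← integral_add (integrable_inner f g) (integrable_inner f' g)]
  exact integral_congr_ae (Eventually.of_forall fun x => inner_add_left (f x) (f' x) (g x))

theorem pairing_add_right (f g g' : VectorTest) :
    pairing f (g + g') = pairing f g + pairing f g' := by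
  unfold pairing
  rw [← integral_add (integrable_inner f g) (integrable_inner f g')]
  exact integral_congr_ae (Eventually.of_forall fun x => inner_add_right (f x) (g x) (g' x))

theorem expA_mul (f f' : VectorTest) : expA f * expA f' = expA (f + f') := by
  ext ψ i
  simp only [mul_apply_eq_comp, expA_apply]
  rw [sub_sub]

theorem expA_zero : expA 0 = 1 := by
  ext ψ i
  simp [expA_apply]

theorem star_expA (f : VectorTest) : star (expA f) = expA (-f) := by
  have h : star (expA f) * expA f = 1 :=
    (ContinuousLinearMap.norm_map_iff_adjoint_comp_self (expA f)).1
      (LinearIsometry.norm_map (phaseShift _ _))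
  calc star (expA f) = star (expA f) * (expA f * expA (-f)) := by
        rw [expA_mul, add_neg_cancel, expA_zero, mul_one]
    _ = expA (-f) := by rw [← mul_assoc, h, one_mul]

/-- `e^{iA(f)}` as a unitary operator. -/
def unitaryA (f : VectorTest) : unitary Op :=
  ⟨expA f, Unitary.mem_iff.2 (by
    rw [star_expA, expA_mul, expA_mul, neg_add_cancel, add_neg_cancel, expA_zero]
    exact ⟨rfl, rfl⟩)⟩

/-- Multiplication by the phase `e^{iℓ(g')}`. -/
def phaseOp (ℓ : VectorTest →+ ℝ) : Op :=
  (phaseShift (Equiv.refl _)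
    (fun i : VectorTest × VectorTest => Circle.exp (ℓ i.2))).toContinuousLinearMap

theorem phaseOp_apply (ℓ : VectorTest →+ ℝ) (ψ : WeylSpace) (i : VectorTest × VectorTest) :
    phaseOp ℓ ψ i = (Circle.exp (ℓ i.2) : ℂ) * ψ i := by
  simp [phaseOp, phaseShift]

theorem phaseOp_mul_neg (ℓ : VectorTest →+ ℝ) : phaseOp ℓ * phaseOp (-ℓ) = 1 := by
  ext ψ i
  simp only [mul_apply_eq_comp, phaseOp_apply, Circle.coe_exp, one_apply_eq_self, ← mul_assoc,
    ← Complex.exp_add]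
  simp

theorem star_phaseOp (ℓ : VectorTest →+ ℝ) : star (phaseOp ℓ) = phaseOp (-ℓ) := by
  have h : star (phaseOp ℓ) * phaseOp ℓ = 1 :=
    (ContinuousLinearMap.norm_map_iff_adjoint_comp_self (phaseOp ℓ)).1
      (LinearIsometry.norm_map (phaseShift _ _))
  calc star (phaseOp ℓ) = star (phaseOp ℓ) * (phaseOp ℓ * phaseOp (-ℓ)) := by
        rw [phaseOp_mul_neg, mul_one]
    _ = phaseOp (-ℓ) := by rw [← mul_assoc, h, one_mul]

/-- Multiplication by the phase `e^{iℓ(g')}` as a unitary operator. -/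
def unitaryPhase (ℓ : VectorTest →+ ℝ) : unitary Op :=
  ⟨phaseOp ℓ, Unitary.mem_iff.2 (by
    rw [star_phaseOp]
    refine ⟨?_, phaseOp_mul_neg ℓ⟩
    simpa using phaseOp_mul_neg (-ℓ))⟩

/-- An automorphism which fixes all `e^{iA(f)}` and multiplies `e^{iE(g)}` by `e^{i c(g)}`. -/
structure IsPhaseAut (α : Op ≃⋆ₐ[ℂ] Op) (c : VectorTest → ℝ) : Prop where
  map_expA : ∀ f, α (expA f) = expA f
  map_expE : ∀ g, α (expE g) = Complex.exp (Complex.I * c g) • expE g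

theorem isPhaseAut_conj_expA (f : VectorTest) :
    IsPhaseAut (Unitary.conjStarAlgAut ℂ Op (unitaryA f)) (pairing f) where
  map_expA f' := by
    rw [Unitary.conjStarAlgAut_apply, unitaryA, star_expA, expA_mul, expA_mul]
    simp
  map_expE g := by
    rw [Unitary.conjStarAlgAut_apply, unitaryA, star_expA, weyl_relation,
      smul_mul_assoc, mul_assoc, expA_mul]
    simp [expA_zero]

/-- $e^{iE(g)}$ shifts the second index by $g$, so conjugation produces the constant phase
$\ell(g')-\ell(g'-g)=\ell(g)$, while $e^{iA(f)}$ does not move that index. Only additivity of $\ell$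
enters; it need not be the pairing with a test function. -/
theorem isPhaseAut_conj_phase (ℓ : VectorTest →+ ℝ) :
    IsPhaseAut (Unitary.conjStarAlgAut ℂ Op (unitaryPhase ℓ)) ℓ where
  map_expA f := by
    rw [Unitary.conjStarAlgAut_apply, unitaryPhase, star_phaseOp]
    ext ψ i
    simp only [mul_apply_eq_comp, phaseOp_apply, expA_apply, Circle.coe_exp, ← mul_assoc,
      ← Complex.exp_add]
    simp
  map_expE g := by
    rw [Unitary.conjStarAlgAut_apply, unitaryPhase, star_phaseOp]
    ext ψ i
    simp only [mul_apply_eq_comp, phaseOp_apply, expE_apply, smul_apply, lp.coeFn_smul,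
      Pi.smul_apply, smul_eq_mul, Circle.coe_exp, ← mul_assoc, ← Complex.exp_add]
    congr 2
    simp only [AddMonoidHom.neg_apply, map_sub]
    push_cast
    ring

theorem norm_starAlgEquiv (α : Op ≃⋆ₐ[ℂ] Op) (A : Op) : ‖α A‖ = ‖A‖ :=
  NonUnitalStarAlgHom.norm_map (α : Op →⋆ₐ[ℂ] Op) α.injective A

theorem continuous_starAlgEquiv (α : Op ≃⋆ₐ[ℂ] Op) : Continuous α :=
  (AddMonoidHomClass.isometry_of_norm α (norm_starAlgEquiv α)).continuous

/-- The induction principle behind all statements on $\mathfrak W(O)$: closed *-subalgebras are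
tested on generators. -/
theorem weylAlgebra_le {O : Opens E3} {S : StarSubalgebra ℂ Op} (hS : IsClosed (S : Set Op))
    (hA : ∀ f : VectorTest, tsupport f ⊆ O → expA f ∈ S)
    (hE : ∀ g : VectorTest, tsupport g ⊆ O → expE g ∈ S) : weylAlgebra O ≤ S := by
  refine StarSubalgebra.topologicalClosure_minimal ?_ hS
  refine StarAlgebra.adjoin_le ?_
  rintro W (⟨f, hf, rfl⟩ | ⟨g, hg, rfl⟩)
  · exact hA f hf
  · exact hE g hg

theorem expA_mem_weylAlgebra {O : Opens E3} {f : VectorTest} (hf : tsupport f ⊆ O) :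
    expA f ∈ weylAlgebra O :=
  StarSubalgebra.le_topologicalClosure _ (StarAlgebra.subset_adjoin ℂ _ (Or.inl ⟨f, hf, rfl⟩))

theorem expE_mem_weylAlgebra {O : Opens E3} {g : VectorTest} (hg : tsupport g ⊆ O) :
    expE g ∈ weylAlgebra O :=
  StarSubalgebra.le_topologicalClosure _ (StarAlgebra.subset_adjoin ℂ _ (Or.inr ⟨g, hg, rfl⟩))

theorem isClosed_weylAlgebra (O : Opens E3) : IsClosed (weylAlgebra O : Set Op) :=
  StarSubalgebra.isClosed_topologicalClosure _

namespace IsPhaseAut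

variable {α α' : Op ≃⋆ₐ[ℂ] Op} {c c' : VectorTest → ℝ}

theorem symm (h : IsPhaseAut α c) : IsPhaseAut α.symm (fun g => -c g) where
  map_expA f := by rw [StarAlgEquiv.symm_apply_eq, h.map_expA]
  map_expE g := by
    rw [StarAlgEquiv.symm_apply_eq, map_smul, h.map_expE, smul_smul, ← Complex.exp_add]
    simp

theorem map_mem_weylAlgebra (h : IsPhaseAut α c) {O : Opens E3} {A : Op} (hA : A ∈ weylAlgebra O) :
    α A ∈ weylAlgebra O := by
  suffices weylAlgebra O ≤ (weylAlgebra O).comap (α : Op →⋆ₐ[ℂ] Op) from this hA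
  refine weylAlgebra_le ((isClosed_weylAlgebra O).preimage (continuous_starAlgEquiv α)) ?_ ?_
  · intro f hf
    change α (expA f) ∈ weylAlgebra O
    rw [h.map_expA]
    exact expA_mem_weylAlgebra hf
  · intro g hg
    change α (expE g) ∈ weylAlgebra O
    rw [h.map_expE]
    exact SMulMemClass.smul_mem _ (expE_mem_weylAlgebra hg)

/-- Gauge invariance survives because $\alpha$ changes $e^{iE(\operatorname{grad}s)}$ only by a
nonzero scalar, which cancels from the commutation relation. -/
theorem map_mem_observables (h : IsPhaseAut α c) {O : Opens E3} {A : Op}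
    (hA : A ∈ observables O) : α A ∈ observables O := by
  refine ⟨h.map_mem_weylAlgebra hA.1, (StarSubalgebra.mem_centralizer_iff ℂ).2 ?_⟩
  have key : ∀ g, expE g * A = A * expE g → expE g * α A = α A * expE g := by
    intro g hg
    have := congrArg α hg
    rw [map_mul, map_mul, h.map_expE, smul_mul_assoc, mul_smul_comm] at this
    exact smul_right_injective Op (Complex.exp_ne_zero _) this
  rintro W ⟨s, rfl⟩
  have := (StarSubalgebra.mem_centralizer_iff ℂ).1 hA.2 _ ⟨s, rfl⟩
  rw [star_expE] at this ⊢
  exact ⟨key _ this.1, key _ this.2⟩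

/-- This permits replacing the bridge on a local algebra by conjugation with a single Weyl operator,
even if the two differ globally. -/
theorem eqOn_weylAlgebra (h : IsPhaseAut α c) (h' : IsPhaseAut α' c') {O : Opens E3}
    (hc : ∀ g : VectorTest, tsupport g ⊆ O → c g = c' g) {A : Op} (hA : A ∈ weylAlgebra O) :
    α A = α' A := by
  suffices weylAlgebra O ≤ StarAlgHom.equalizer (α : Op →⋆ₐ[ℂ] Op) (α' : Op →⋆ₐ[ℂ] Op) from this hA
  refine weylAlgebra_le
    (isClosed_eq (continuous_starAlgEquiv α) (continuous_starAlgEquiv α')) ?_ ?_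
  · intro f _
    change α (expA f) = α' (expA f)
    rw [h.map_expA, h'.map_expA]
  · intro g hg
    change α (expE g) = α' (expE g)
    rw [h.map_expE, h'.map_expE, hc g hg]

/-- The operators on which a family of automorphisms converges pointwise. -/
def convergenceAlgebra {ι : Type} (l : Filter ι) (α : ι → Op ≃⋆ₐ[ℂ] Op) (α' : Op ≃⋆ₐ[ℂ] Op) :
    StarSubalgebra ℂ Op where
  carrier := {A | Tendsto (fun i => α i A) l (𝓝 (α' A))}
  mul_mem' {A B} hA hB := by
    simp only [mem_ofPred_eq, map_mul] at *
    exact hA.mul hB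
  add_mem' {A B} hA hB := by
    simp only [mem_ofPred_eq, map_add] at *
    exact hA.add hB
  algebraMap_mem' r := by
    simp only [mem_ofPred_eq, AlgHomClass.commutes]
    exact tendsto_const_nhds
  star_mem' {A} hA := by
    simp only [mem_ofPred_eq, map_star] at *
    exact hA.star

/-- All maps involved are isometric, so an $\varepsilon/3$ argument applies. -/
theorem isClosed_convergenceAlgebra {ι : Type} (l : Filter ι) (α : ι → Op ≃⋆ₐ[ℂ] Op)
    (α' : Op ≃⋆ₐ[ℂ] Op) : IsClosed (convergenceAlgebra l α α' : Set Op) := by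
  refine isClosed_of_closure_subset fun A hA => ?_
  refine Metric.tendsto_nhds.2 fun ε hε => ?_
  obtain ⟨B, hB, hAB⟩ := Metric.mem_closure_iff.1 hA (ε / 3) (by positivity)
  filter_upwards [Metric.tendsto_nhds.1 hB (ε / 3) (by positivity)] with i hi
  have h1 : dist (α i A) (α i B) = dist A B := by
    rw [dist_eq_norm, dist_eq_norm, ← map_sub, norm_starAlgEquiv]
  have h2 : dist (α' B) (α' A) = dist A B := by
    rw [dist_comm, dist_eq_norm, dist_eq_norm, ← map_sub, norm_starAlgEquiv]
  calc dist (α i A) (α' A) ≤ dist (α i A) (α i B) + dist (α i B) (α' B) + dist (α' B) (α' A) :=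
        dist_triangle4 _ _ _ _
    _ < ε := by rw [h1, h2]; linarith

theorem tendsto {ι : Type} {l : Filter ι} {α : ι → Op ≃⋆ₐ[ℂ] Op} {c : ι → VectorTest → ℝ}
    (h : ∀ i, IsPhaseAut (α i) (c i)) (h' : IsPhaseAut α' c')
    (hc : ∀ g, Tendsto (fun i => c i g) l (𝓝 (c' g))) {O : Opens E3} {A : Op}
    (hA : A ∈ weylAlgebra O) : Tendsto (fun i => α i A) l (𝓝 (α' A)) := by
  suffices weylAlgebra O ≤ convergenceAlgebra l α α' from this hA
  refine weylAlgebra_le (isClosed_convergenceAlgebra l α α') ?_ ?_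
  · intro f _
    change Tendsto (fun i => α i (expA f)) l (𝓝 (α' (expA f)))
    simp only [(h _).map_expA, h'.map_expA]
    exact tendsto_const_nhds
  · intro g _
    change Tendsto (fun i => α i (expE g)) l (𝓝 (α' (expE g)))
    simp only [(h _).map_expE, h'.map_expE]
    refine Tendsto.smul_const ?_ _
    refine (Complex.continuous_exp.tendsto _).comp (tendsto_const_nhds.mul ?_)
    exact (Complex.continuous_ofReal.tendsto _).comp (hc g)

/-- The restriction of a phase automorphism to the algebra of observables. -/
def restrict (h : IsPhaseAut α c) (O : Opens E3) : observables O ≃⋆ₐ[ℂ] observables O where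
  toFun A := ⟨α A, h.map_mem_observables A.2⟩
  invFun A := ⟨α.symm A, h.symm.map_mem_observables A.2⟩
  left_inv _ := Subtype.ext (α.symm_apply_apply _)
  right_inv _ := Subtype.ext (α.apply_symm_apply _)
  map_mul' _ _ := Subtype.ext (map_mul α _ _)
  map_add' _ _ := Subtype.ext (map_add α _ _)
  map_star' _ := Subtype.ext (map_star α _)
  map_smul' r _ := Subtype.ext (map_smul α r _)

theorem mem_observables_iff (h : IsPhaseAut α c) {O : Opens E3} {A : Op} :
    A ∈ observables O ↔ α A ∈ observables O :=
  ⟨h.map_mem_observables, fun hA => by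
    simpa using h.symm.map_mem_observables hA⟩

end IsPhaseAut

/-! ### The limit functional of a gauge bridge -/

theorem inner_grad (S : ScalarTest) (x v : E3) : inner ℝ v (grad S x) = fderiv ℝ S x v := by
  change inner ℝ v (gradient S x) = _
  rw [real_inner_comm, gradient, InnerProductSpace.toDual_symm_apply]

namespace BridgeData

variable {x₁ x₂ : E3} {q : ℝ} (D : BridgeData x₁ x₂ q)

/-- The contribution of the parameter value `u` to the pairing of the bridge with `g`. -/
def flux (g : VectorTest) (u : ℝ) : ℝ :=
  ∫ y, D.profile y * inner ℝ (D.velocityAt y u) (g (D.pathAt y u))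

theorem continuousOn_pathAt :
    ContinuousOn (fun z : ℝ × E3 => D.pathAt z.2 z.1) (Icc 0 1 ×ˢ univ) := by
  refine ContinuousOn.add ?_ (by fun_prop)
  exact D.smooth.continuousOn.comp continuousOn_fst fun z hz => hz.1

theorem continuousOn_velocityAt :
    ContinuousOn (fun z : ℝ × E3 => D.velocityAt z.2 z.1) (Icc 0 1 ×ˢ univ) := by
  refine ContinuousOn.add ?_ (by fun_prop)
  exact D.continuousOn_derivWithin.comp continuousOn_fst fun z hz => hz.1

/-- In the variable $y$ the singular factor $(u(1-u))^{-3}$ of `slice` is gone: the integrand is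
continuous up to $u=0$ and $u=1$, and the profile confines $y$ to a compact set. This is why the
cutoff can be removed. -/
theorem integrableOn_flux (g : VectorTest) :
    IntegrableOn (fun z : ℝ × E3 =>
      D.profile z.2 * inner ℝ (D.velocityAt z.2 z.1) (g (D.pathAt z.2 z.1))) (Icc 0 1 ×ˢ univ)
      (volume.prod volume) := by
  have hc : ContinuousOn (fun z : ℝ × E3 =>
      D.profile z.2 * inner ℝ (D.velocityAt z.2 z.1) (g (D.pathAt z.2 z.1)))
      (Icc 0 1 ×ˢ univ) :=
    (D.profile.continuous.comp continuous_snd).continuousOn.mul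
      (D.continuousOn_velocityAt.inner (g.continuous.comp_continuousOn D.continuousOn_pathAt))
  have hi : IntegrableOn (fun z : ℝ × E3 =>
      D.profile z.2 * inner ℝ (D.velocityAt z.2 z.1) (g (D.pathAt z.2 z.1)))
      (Icc 0 1 ×ˢ tsupport D.profile) (volume.prod volume) :=
    (hc.mono (prod_mono_right (subset_univ _))).integrableOn_compact
      (isCompact_Icc.prod D.profile.hasCompactSupport)
  refine hi.of_forall_sdiff_eq_zero (measurableSet_Icc.prod MeasurableSet.univ) ?_
  rintro ⟨u, y⟩ ⟨h1, h2⟩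
  have : y ∉ tsupport D.profile := fun h => h2 ⟨h1.1, h⟩
  simp [image_eq_zero_of_notMem_tsupport this]

theorem integrable_flux (g : VectorTest) {a b : ℝ} (h : Icc a b ⊆ Icc 0 1) :
    Integrable (fun z : ℝ × E3 =>
      D.profile z.2 * inner ℝ (D.velocityAt z.2 z.1) (g (D.pathAt z.2 z.1)))
      ((volume.restrict (Icc a b)).prod volume) := by
  have := (D.integrableOn_flux g).mono_set (prod_mono_left (t := univ) h)
  rw [IntegrableOn, ← Measure.prod_restrict, Measure.restrict_univ] at this
  exact this

theorem integrableOn_flux_Icc (g : VectorTest) : IntegrableOn (D.flux g) (Icc 0 1) :=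
  (D.integrable_flux g subset_rfl).integral_prod_left

theorem continuousOn_slice {ε : ℝ} (hε : 0 < ε) :
    ContinuousOn (fun z : E3 × ℝ => D.slice z.2 z.1) (univ ×ˢ Icc ε (1 - ε)) := by
  have hsub : Icc ε (1 - ε) ⊆ Icc 0 1 := Icc_subset_Icc hε.le (by linarith)
  have hk : ContinuousOn (fun z : E3 × ℝ => (z.2 * (1 - z.2))⁻¹) (univ ×ˢ Icc ε (1 - ε)) :=
    ContinuousOn.inv₀ (by fun_prop) fun z hz =>
      (mul_pos (hε.trans_le hz.2.1) (by linarith [hz.2.2])).ne'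
  have hp : ContinuousOn (fun z : E3 × ℝ => (z.2 * (1 - z.2))⁻¹ • (z.1 - D.path z.2))
      (univ ×ˢ Icc ε (1 - ε)) :=
    hk.smul (continuousOn_fst.sub (D.smooth.continuousOn.comp continuousOn_snd
      fun z hz => hsub hz.2))
  refine ((hk.pow 3).mul (D.profile.continuous.comp_continuousOn hp)).smul ?_
  have h2 : ContinuousOn (fun z : E3 × ℝ => 1 - 2 * z.2) (univ ×ˢ Icc ε (1 - ε)) := by fun_prop
  refine ContinuousOn.add ?_ (h2.smul hp)
  exact D.continuousOn_derivWithin.comp continuousOn_snd fun z hz => hsub hz.2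

theorem cutoff_apply {ε : ℝ} (hε : 0 < ε) (x : E3) : D.cutoff ε x = D.cutoffFun ε x := by
  rw [cutoff, dif_pos hε]
  rfl

/-- Fubini, followed by the substitution of `integral_inner_slice` for each $u$. The cutoff keeps
`slice` continuous and the support of $g$ makes the domain compact. -/
theorem pairing_cutoff {ε : ℝ} (hε : 0 < ε) (g : VectorTest) :
    pairing (D.cutoff ε) g = ∫ u in Icc ε (1 - ε), D.flux g u := by
  have hs := D.continuousOn_slice hε
  have hc : ContinuousOn (fun z : E3 × ℝ => inner ℝ (D.slice z.2 z.1) (g z.1))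
      (univ ×ˢ Icc ε (1 - ε)) := hs.inner (g.continuous.comp continuous_fst).continuousOn
  have hint : Integrable (fun z : E3 × ℝ => inner ℝ (D.slice z.2 z.1) (g z.1))
      (volume.prod (volume.restrict (Icc ε (1 - ε)))) := by
    have hi : IntegrableOn (fun z : E3 × ℝ => inner ℝ (D.slice z.2 z.1) (g z.1))
        (tsupport g ×ˢ Icc ε (1 - ε)) (volume.prod volume) :=
      (hc.mono (prod_mono_left (subset_univ _))).integrableOn_compact
        (g.hasCompactSupport.isCompact.prod isCompact_Icc)
    have hi' := hi.of_forall_sdiff_eq_zero (t := univ ×ˢ Icc ε (1 - ε))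
      (MeasurableSet.univ.prod measurableSet_Icc) (by
        rintro ⟨x, u⟩ ⟨h1, h2⟩
        have : x ∉ tsupport g := fun h => h2 ⟨h, h1.2⟩
        simp [image_eq_zero_of_notMem_tsupport this])
    rw [IntegrableOn, ← Measure.prod_restrict, Measure.restrict_univ] at hi'
    exact hi'
  calc pairing (D.cutoff ε) g
      = ∫ x, ∫ u in Icc ε (1 - ε), inner ℝ (D.slice u x) (g x) := by
        refine integral_congr_ae (Eventually.of_forall fun x => ?_)
        have hi : IntegrableOn (fun u => D.slice u x) (Icc ε (1 - ε)) :=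
          (hs.comp (f := fun u : ℝ => (x, u)) (by fun_prop)
            fun u hu => ⟨mem_univ _, hu⟩).integrableOn_compact isCompact_Icc
        simp only [D.cutoff_apply hε, cutoffFun]
        rw [real_inner_comm, ← integral_inner hi]
        simp only [real_inner_comm]
    _ = ∫ u in Icc ε (1 - ε), ∫ x, inner ℝ (D.slice u x) (g x) := integral_integral_swap hint
    _ = ∫ u in Icc ε (1 - ε), D.flux g u := by
        refine setIntegral_congr_fun measurableSet_Icc fun u hu => ?_
        exact D.integral_inner_slice ⟨hε.trans_le hu.1, by linarith [hu.2]⟩ g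

theorem tendsto_pairing_cutoff (g : VectorTest) :
    Tendsto (fun ε => pairing (D.cutoff ε) g) (𝓝[>] 0) (𝓝 (∫ u in Ioo 0 1, D.flux g u)) := by
  have hid : Tendsto (fun ε : ℝ => ε) (𝓝[>] 0) (𝓝 0) := tendsto_id.mono_left nhdsWithin_le_nhds
  have hsub : Tendsto (fun ε : ℝ => 1 - ε) (𝓝[>] 0) (𝓝 1) := by
    simpa using hid.const_sub 1
  have hcov := aecover_Ioo_of_Icc (μ := (volume : Measure ℝ)) hid hsub
  have h := hcov.integral_tendsto_of_countably_generated
    ((D.integrableOn_flux_Icc g).mono_set Ioo_subset_Icc_self)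
  refine h.congr' ?_
  filter_upwards [self_mem_nhdsWithin] with ε hε
  have hε : 0 < ε := hε
  rw [D.pairing_cutoff hε, Measure.restrict_restrict measurableSet_Icc, inter_eq_left.2]
  intro u hu
  exact ⟨hε.trans_le hu.1, by linarith [hu.2]⟩

/-- The limit of the functionals `g ↦ ⟨b_ε, g⟩`. -/
def fluxFunctional : VectorTest →+ ℝ :=
  AddMonoidHom.mk' (fun g => ∫ u in Ioo 0 1, D.flux g u) fun g g' => by
    -- Additivity is inherited from the pairings with $b_\varepsilon$ in the limit.
    refine tendsto_nhds_unique (D.tendsto_pairing_cutoff (g + g')) ?_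
    simp only [pairing_add_right]
    exact (D.tendsto_pairing_cutoff g).add (D.tendsto_pairing_cutoff g')

theorem tendsto_pairing_fluxFunctional (g : VectorTest) :
    Tendsto (fun ε => pairing (D.cutoff ε) g) (𝓝[>] 0) (𝓝 (D.fluxFunctional g)) :=
  D.tendsto_pairing_cutoff g

/-- For fixed $y$ the integrand is the derivative of $u\mapsto S(\gamma_y(u))$, so only the end
points of $[\varepsilon,1-\varepsilon]$ survive. -/
theorem pairing_cutoff_grad {ε : ℝ} (hε : 0 < ε) (hε' : ε ≤ 1 / 2) (S : ScalarTest) :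
    pairing (D.cutoff ε) (grad S) =
      ∫ y, D.profile y * (S (D.pathAt y (1 - ε)) - S (D.pathAt y ε)) := by
  have hsub : Icc ε (1 - ε) ⊆ Icc 0 1 := Icc_subset_Icc hε.le (by linarith)
  rw [D.pairing_cutoff hε]
  unfold flux
  rw [integral_integral_swap (D.integrable_flux (grad S) hsub)]
  refine integral_congr_ae (Eventually.of_forall fun y => ?_)
  have hc : ContinuousOn (fun u : ℝ => inner ℝ (D.velocityAt y u) (grad S (D.pathAt y u)))
      (Icc ε (1 - ε)) := by
    have h1 := D.continuousOn_velocityAt.comp (f := fun u : ℝ => (u, y)) (s := Icc ε (1 - ε))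
      (by fun_prop) fun u hu => ⟨hsub hu, mem_univ _⟩
    have h2 := D.continuousOn_pathAt.comp (f := fun u : ℝ => (u, y)) (s := Icc ε (1 - ε))
      (by fun_prop) fun u hu => ⟨hsub hu, mem_univ _⟩
    exact h1.inner ((grad S).continuous.comp_continuousOn h2)
  have hle : ε ≤ 1 - ε := by linarith
  simp only
  rw [integral_const_mul, integral_Icc_eq_integral_Ioc, ← intervalIntegral.integral_of_le hle]
  congr 1
  refine intervalIntegral.integral_eq_sub_of_hasDerivAt (f := fun u => S (D.pathAt y u)) ?_
    (hc.intervalIntegrable_of_Icc hle)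
  intro u hu
  rw [uIcc_of_le hle] at hu
  have hu0 : 0 < u := hε.trans_le hu.1
  have hu1 : u < 1 := by linarith [hu.2]
  -- Away from $0$ and $1$ the derivative within $[0,1]$ is an ordinary derivative.
  have hn : Icc (0 : ℝ) 1 ∈ 𝓝 u := Icc_mem_nhds hu0 hu1
  have hp : HasDerivAt D.path (derivWithin D.path (Icc 0 1) u) u :=
    ((D.smooth.differentiableOn (by simp)) u ⟨hu0.le, hu1.le⟩).hasDerivWithinAt.hasDerivAt hn
  have hk : HasDerivAt (fun u : ℝ => u * (1 - u)) (1 - 2 * u) u := by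
    refine ((hasDerivAt_id' u).mul ((hasDerivAt_id' u).const_sub 1)).congr_deriv ?_
    ring
  have hpath : HasDerivAt (D.pathAt y) (D.velocityAt y u) u := hp.add (hk.smul_const y)
  have hS : HasFDerivAt S (fderiv ℝ S (D.pathAt y u)) (D.pathAt y u) :=
    (S.contDiff.differentiable (by simp) _).hasFDerivAt
  rw [inner_grad]
  exact hS.comp_hasDerivAt u hpath

theorem tendsto_path_source : Tendsto D.path (𝓝[>] 0) (𝓝 x₁) := by
  have := (D.smooth.continuousOn 0 ⟨le_rfl, zero_le_one⟩).tendsto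
  rw [D.source] at this
  refine this.mono_left ?_
  rw [← nhdsWithin_Ioo_eq_nhdsGT (zero_lt_one' ℝ)]
  exact nhdsWithin_mono _ Ioo_subset_Icc_self

theorem tendsto_width : Tendsto (fun u : ℝ => |u * (1 - u)| * D.R) (𝓝[>] 0) (𝓝 0) := by
  have : Continuous (fun u : ℝ => |u * (1 - u)| * D.R) := by fun_prop
  have := this.tendsto 0
  simp only [zero_mul, abs_zero] at this
  exact this.mono_left nhdsWithin_le_nhds

/-- The bundle of paths $\gamma_y$ pinches at its ends: $\gamma(u)\to x_1$, and the deviation from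
$\gamma$ is at most $|u(1-u)|R$. -/
theorem eventually_pathAt_source {N : Set E3} (hN : N ∈ 𝓝 x₁) :
    ∀ᶠ u in 𝓝[>] (0 : ℝ), ∀ y ∈ tsupport D.profile, D.pathAt y u ∈ N := by
  obtain ⟨r, hr, hN⟩ := Metric.mem_nhds_iff.1 hN
  filter_upwards [D.tendsto_path_source (Metric.ball_mem_nhds _ (half_pos hr)),
    D.tendsto_width (Iio_mem_nhds (half_pos hr))] with u hu hu' y hy
  refine hN ?_
  have hy' : ‖y‖ < D.R := by simpa using D.profile_support hy
  have h3 : ‖(u * (1 - u)) • y‖ ≤ |u * (1 - u)| * D.R := by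
    rw [norm_smul, Real.norm_eq_abs]
    exact mul_le_mul_of_nonneg_left hy'.le (abs_nonneg _)
  have hu1 : ‖D.path u - x₁‖ < r / 2 := by simpa [dist_eq_norm] using hu
  have hu2 : |u * (1 - u)| * D.R < r / 2 := hu'
  rw [mem_ball_iff_norm, pathAt, add_sub_right_comm]
  exact (norm_add_le _ _).trans_lt (by linarith)

/-- The bridge traversed backwards, from `x₂` to `x₁`. -/
def reverse : BridgeData x₂ x₁ q where
  path u := D.path (1 - u)
  smooth := D.smooth.comp (contDiff_const.sub contDiff_id).contDiffOn
    fun u hu => ⟨sub_nonneg.2 hu.2, sub_le_self _ hu.1⟩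
  simple u hu v hv h := sub_right_injective (D.simple (⟨sub_nonneg.2 hu.2, sub_le_self _ hu.1⟩)
    (⟨sub_nonneg.2 hv.2, sub_le_self _ hv.1⟩) h)
  source := by simp [D.target]
  target := by simp [D.source]
  R := D.R
  R_pos := D.R_pos
  away_left u hu := by
    have := D.away_right (1 - u) ⟨sub_pos.2 hu.2, sub_lt_self _ hu.1⟩
    rwa [sub_sub_cancel, mul_comm (1 - u)⁻¹] at this
  away_right u hu := by
    have := D.away_left (1 - u) ⟨sub_pos.2 hu.2, sub_lt_self _ hu.1⟩
    rwa [sub_sub_cancel, mul_comm (1 - u)⁻¹] at this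
  profile := D.profile
  profile_support := D.profile_support
  profile_integral := D.profile_integral

theorem tendsto_path_target : Tendsto (fun u => D.path (1 - u)) (𝓝[>] 0) (𝓝 x₂) :=
  D.reverse.tendsto_path_source

theorem eventually_pathAt_target {N : Set E3} (hN : N ∈ 𝓝 x₂) :
    ∀ᶠ u in 𝓝[>] (0 : ℝ), ∀ y ∈ tsupport D.profile, D.pathAt y (1 - u) ∈ N := by
  filter_upwards [D.reverse.eventually_pathAt_source hN] with u hu y hy
  have := hu y hy
  simpa [pathAt, reverse, mul_comm] using this

/-- For small $\varepsilon$ all end points $\gamma_y(\varepsilon)$, $\gamma_y(1-\varepsilon)$ lie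
where $S$ is constant, and the integral of the profile supplies $q$. -/
theorem eventually_pairing_cutoff_grad {S : ScalarTest} {c₁ c₂ : ℝ}
    (h₁ : ∀ᶠ x in 𝓝 x₁, S x = c₁) (h₂ : ∀ᶠ x in 𝓝 x₂, S x = c₂) :
    ∀ᶠ ε in 𝓝[>] (0 : ℝ), pairing (D.cutoff ε) (grad S) = q * (c₂ - c₁) := by
  filter_upwards [D.eventually_pathAt_source h₁, D.eventually_pathAt_target h₂,
    Ioo_mem_nhdsGT (one_half_pos (α := ℝ))] with ε hε₁ hε₂ hε
  rw [D.pairing_cutoff_grad hε.1 hε.2.le]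
  refine Eq.trans ?_ (congrArg (· * (c₂ - c₁)) D.profile_integral)
  rw [← integral_mul_const]
  refine integral_congr_ae (Eventually.of_forall fun y => ?_)
  by_cases hy : y ∈ tsupport D.profile
  · have e1 := hε₁ y hy
    have e2 := hε₂ y hy
    simp only [e1, e2]
  · simp [image_eq_zero_of_notMem_tsupport hy]

theorem fluxFunctional_grad {S : ScalarTest} {c₁ c₂ : ℝ}
    (h₁ : ∀ᶠ x in 𝓝 x₁, S x = c₁) (h₂ : ∀ᶠ x in 𝓝 x₂, S x = c₂) :
    D.fluxFunctional (grad S) = q * (c₂ - c₁) :=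
  tendsto_nhds_unique (D.tendsto_pairing_fluxFunctional _)
    (tendsto_const_nhds.congr' <| (D.eventually_pairing_cutoff_grad h₁ h₂).mono fun _ h => h.symm)

/-- The pieces of the bridge removed by the cutoff are close to $x_1$ or $x_2$, hence off $K$. The
threshold for $\varepsilon$ depends on $K$ only, not on $g$. -/
theorem eventually_pairing_cutoff_eq {K : Set E3} (hK : IsClosed K) (h₁ : x₁ ∉ K) (h₂ : x₂ ∉ K) :
    ∀ᶠ ε in 𝓝[>] (0 : ℝ), ∀ g : VectorTest, tsupport g ⊆ K →
      pairing (D.cutoff ε) g = D.fluxFunctional g := by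
  obtain ⟨a, ha0, ha⟩ := mem_nhdsGT_iff_exists_Ioo_subset.1
    (D.eventually_pathAt_source (hK.isOpen_compl.mem_nhds h₁))
  obtain ⟨b, hb0, hb⟩ := mem_nhdsGT_iff_exists_Ioo_subset.1
    (D.eventually_pathAt_target (hK.isOpen_compl.mem_nhds h₂))
  filter_upwards [Ioo_mem_nhdsGT (mem_Ioi.1 ha0), Ioo_mem_nhdsGT (mem_Ioi.1 hb0)]
    with ε hεa hεb g hg
  rw [D.pairing_cutoff hεa.1]
  refine (setIntegral_eq_of_subset_of_forall_sdiff_eq_zero measurableSet_Ioo ?_ ?_).symm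
  · exact fun u hu => ⟨hεa.1.trans_le hu.1, by linarith [hu.2, hεa.1]⟩
  · intro u hu
    refine integral_eq_zero_of_ae (Eventually.of_forall fun y => ?_)
    by_cases hy : y ∈ tsupport D.profile
    · have : D.pathAt y u ∉ K := by
        by_cases hu' : u < ε
        · exact ha ⟨hu.1.1, hu'.trans hεa.2⟩ y hy
        · have hu'' : 1 - ε < u := by
            by_contra h
            exact hu.2 ⟨not_lt.1 hu', not_lt.1 h⟩
          have := hb (a := 1 - u) ⟨by linarith [hu.1.2], by linarith [hεb.2]⟩ y hy
          rwa [sub_sub_cancel] at this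
      simp [image_eq_zero_of_notMem_tsupport fun h => this (hg h)]
    · simp [image_eq_zero_of_notMem_tsupport hy]

end BridgeData

/-! ### Transport of charge densities -/

/-- The translate `x ↦ ρ(x - p)` of a scalar test function. -/
def translate (ρ : ScalarTest) (p : E3) : ScalarTest where
  toFun x := ρ (x - p)
  contDiff' := by
    have : ContDiff ℝ ∞ (ρ : E3 → ℝ) := ρ.contDiff
    fun_prop
  hasCompactSupport' := ρ.hasCompactSupport.comp_homeomorph (Homeomorph.subRight p)
  tsupport_subset' := fun _ _ => trivial

theorem translate_apply (ρ : ScalarTest) (p x : E3) : translate ρ p x = ρ (x - p) := rfl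

/-- The vector test function `x ↦ φ(x) v`. -/
def smulVector (φ : ScalarTest) (v : E3) : VectorTest where
  toFun x := φ x • v
  contDiff' := by
    have : ContDiff ℝ ∞ (φ : E3 → ℝ) := φ.contDiff
    fun_prop
  hasCompactSupport' := φ.hasCompactSupport.smul_right
  tsupport_subset' := fun _ _ => trivial

theorem smulVector_apply (φ : ScalarTest) (v x : E3) : smulVector φ v x = φ x • v := rfl

/-- The average of the translates of `ρ` by `t v`, `0 ≤ t ≤ 1`. -/
def tubeFun (ρ : ScalarTest) (v x : E3) : ℝ := ∫ t in Icc (0 : ℝ) 1, ρ (x - t • v)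

theorem support_tubeFun_subset (ρ : ScalarTest) (v : E3) :
    Function.support (tubeFun ρ v) ⊆
      (fun z : ℝ × E3 => z.1 • v + z.2) '' (Icc 0 1 ×ˢ tsupport ρ) := by
  intro x hx
  by_contra hn
  refine hx (setIntegral_eq_zero_of_forall_eq_zero fun t ht => ?_)
  by_contra h
  exact hn ⟨(t, x - t • v), ⟨ht, subset_tsupport _ h⟩, by simp⟩

theorem isCompact_tube (ρ : ScalarTest) (v : E3) :
    IsCompact ((fun z : ℝ × E3 => z.1 • v + z.2) '' (Icc (0 : ℝ) 1 ×ˢ tsupport ρ)) :=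
  (isCompact_Icc.prod ρ.hasCompactSupport).image (by fun_prop)

/-- The average of the translates of `ρ` by `t v`, `0 ≤ t ≤ 1`, as a test function. -/
def tube (ρ : ScalarTest) (v : E3) : ScalarTest where
  toFun := tubeFun ρ v
  contDiff' := by
    have hρ : ContDiff ℝ ∞ (ρ : E3 → ℝ) := ρ.contDiff
    refine contDiff_setIntegral_of_compact volume isCompact_Icc (fun t : ℝ => t • v)
      (by fun_prop) (fun z : E3 × E3 => ρ (z.2 - z.1)) ?_
    fun_prop
  hasCompactSupport' :=
    HasCompactSupport.of_support_subset_isCompact (isCompact_tube ρ v) (support_tubeFun_subset ρ v)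
  tsupport_subset' := fun _ _ => trivial

theorem tsupport_tube_subset (ρ : ScalarTest) (v : E3) :
    tsupport (tube ρ v) ⊆ (fun z : ℝ × E3 => z.1 • v + z.2) '' (Icc 0 1 ×ˢ tsupport ρ) :=
  closure_minimal (support_tubeFun_subset ρ v) (isCompact_tube ρ v).isClosed

/-- Moving $x$ by $hv$ amounts to shifting the interval of integration by $-h$, so the derivative in
direction $v$ is a difference of boundary values. The tube thus has the difference of two translates
as its derivative along $v$. -/
theorem fderiv_tube (ρ : ScalarTest) (v x : E3) :
    fderiv ℝ (tube ρ v) x v = ρ x - ρ (x - v) := by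
  have hc : Continuous (fun t : ℝ => ρ (x - t • v)) := ρ.continuous.comp (by fun_prop)
  have h1 : HasDerivAt (fun h : ℝ => tube ρ v (x + h • v)) (fderiv ℝ (tube ρ v) x v) 0 := by
    have hφ : HasFDerivAt (tube ρ v) (fderiv ℝ (tube ρ v) x) (x + (0 : ℝ) • v) := by
      rw [zero_smul, add_zero]
      exact ((tube ρ v).contDiff.differentiable (by simp) _).hasFDerivAt
    have hl : HasDerivAt (fun h : ℝ => x + h • v) v 0 := by
      simpa using ((hasDerivAt_id (0 : ℝ)).smul_const v).const_add x
    exact hφ.comp_hasDerivAt 0 hl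
  have h2 : (fun h : ℝ => tube ρ v (x + h • v)) =
      fun h : ℝ => ∫ t in (0 - h)..(1 - h), ρ (x - t • v) := by
    funext h
    rw [← intervalIntegral.integral_comp_sub_right (fun t => ρ (x - t • v)) h]
    change tubeFun ρ v _ = _
    rw [tubeFun, integral_Icc_eq_integral_Ioc, ← intervalIntegral.integral_of_le zero_le_one]
    refine intervalIntegral.integral_congr fun t _ => ?_
    congr 1
    module
  have h3 : HasDerivAt (fun h : ℝ => ∫ t in (0 - h)..(1 - h), ρ (x - t • v))
      (ρ x - ρ (x - v)) 0 := by
    have hF : ∀ b : ℝ, HasDerivAt (fun b => ∫ t in (0 : ℝ)..b, ρ (x - t • v)) (ρ (x - b • v)) b :=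
      fun b => intervalIntegral.integral_hasDerivAt_right (hc.intervalIntegrable _ _)
        hc.stronglyMeasurable.stronglyMeasurableAtFilter hc.continuousAt
    have e : (fun h : ℝ => ∫ t in (0 - h)..(1 - h), ρ (x - t • v)) = fun h =>
        (∫ t in (0 : ℝ)..(1 - h), ρ (x - t • v)) - ∫ t in (0 : ℝ)..(0 - h), ρ (x - t • v) := by
      funext h
      rw [intervalIntegral.integral_interval_sub_left] <;> exact hc.intervalIntegrable _ _
    rw [e]
    have g1 := (hF (1 - 0)).comp (0 : ℝ) ((hasDerivAt_id' (0 : ℝ)).const_sub 1)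
    have g2 := (hF (0 - 0)).comp (0 : ℝ) ((hasDerivAt_id' (0 : ℝ)).const_sub 0)
    refine (g1.sub g2).congr_deriv ?_
    simp
    ring
  rw [h2] at h1
  exact h1.unique h3

/-- Integration by parts in the direction $v$; compact supports leave no boundary term. -/
theorem pairing_smulVector_grad (φ S : ScalarTest) (v : E3) :
    pairing (smulVector φ v) (grad S) = -∫ x, fderiv ℝ φ x v * S x := by
  have hφ : ContDiff ℝ ∞ (φ : E3 → ℝ) := φ.contDiff
  have hS : ContDiff ℝ ∞ (S : E3 → ℝ) := S.contDiff
  have hφ' : Continuous (fun x => fderiv ℝ φ x v) :=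
    (hφ.continuous_fderiv (by simp)).clm_apply continuous_const
  have hS' : Continuous (fun x => fderiv ℝ S x v) :=
    (hS.continuous_fderiv (by simp)).clm_apply continuous_const
  rw [← integral_mul_fderiv_eq_neg_fderiv_mul_of_integrable]
  · refine integral_congr_ae (Eventually.of_forall fun x => ?_)
    simp only [smulVector_apply, inner_smul_left, inner_grad]
    rfl
  · exact (hφ'.mul hS.continuous).integrable_of_hasCompactSupport S.hasCompactSupport.mul_left
  · exact (hφ.continuous.mul hS').integrable_of_hasCompactSupport φ.hasCompactSupport.mul_right
  · exact (hφ.continuous.mul hS.continuous).integrable_of_hasCompactSupport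
      φ.hasCompactSupport.mul_right
  · exact fun x _ => hφ.differentiable (by simp) x
  · exact fun x _ => hS.differentiable (by simp) x

/-- The field transporting the charge density `ρ(· - p)` to `ρ(· - p')` along a segment. -/
def segmentField (ρ : ScalarTest) (p p' : E3) : VectorTest :=
  smulVector (tube (translate ρ p) (p' - p)) (p' - p)

theorem integrable_mul_shift (ρ S : ScalarTest) (p : E3) :
    Integrable (fun x => ρ x * S (p + x)) := by
  refine Continuous.integrable_of_hasCompactSupport ?_ ρ.hasCompactSupport.mul_right
  exact ρ.continuous.mul (S.continuous.comp (by fun_prop))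

/-- The weak form of $\operatorname{div}c=\rho(\cdot-p)-\rho(\cdot-p')$ for the segment field $c$,
obtained from `fderiv_tube`. -/
theorem pairing_segmentField (ρ S : ScalarTest) (p p' : E3) :
    pairing (segmentField ρ p p') (grad S) = ∫ x, ρ x * (S (p' + x) - S (p + x)) := by
  have key : ∀ p : E3, ∫ x, ρ (x - p) * S x = ∫ x, ρ x * S (p + x) := by
    intro p
    rw [← integral_add_left_eq_self _ p]
    simp
  have hint : ∀ p : E3, Integrable (fun x => ρ (x - p) * S x) := by
    intro p
    refine Continuous.integrable_of_hasCompactSupport ?_ S.hasCompactSupport.mul_left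
    exact (ρ.continuous.comp (by fun_prop)).mul S.continuous
  rw [segmentField, pairing_smulVector_grad]
  simp only [fderiv_tube, translate_apply, mul_sub, sub_mul]
  rw [integral_sub (integrable_mul_shift ρ S p') (integrable_mul_shift ρ S p), ← key, ← key,
    ← integral_sub (hint p') (hint p), ← integral_neg]
  refine integral_congr_ae (Eventually.of_forall fun x => ?_)
  simp only [sub_sub, sub_add_cancel]
  ring

/-- The segment stays in the convex ball of radius $r/2$, and the density adds less than $r/2$. -/
theorem tsupport_segmentField_subset {ρ : ScalarTest} {a p p' : E3} {r : ℝ}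
    (hp : p ∈ Metric.ball a (r / 2)) (hp' : p' ∈ Metric.ball a (r / 2))
    (hρ : tsupport ρ ⊆ Metric.ball 0 (r / 2)) :
    tsupport (segmentField ρ p p') ⊆ Metric.ball a r := by
  have h1 : tsupport (segmentField ρ p p') ⊆ tsupport (tube (translate ρ p) (p' - p)) :=
    closure_mono fun x hx h => hx (by simp [segmentField, smulVector_apply, h])
  refine (h1.trans (tsupport_tube_subset _ _)).trans ?_
  rintro _ ⟨⟨t, z⟩, ⟨ht, hz⟩, rfl⟩
  have hz' : z - p ∈ Metric.ball (0 : E3) (r / 2) := by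
    refine hρ ?_
    have : tsupport (translate ρ p) ⊆ (fun x => x - p) ⁻¹' tsupport ρ :=
      closure_minimal (fun x hx => subset_tsupport _ hx)
        ((isClosed_tsupport _).preimage (by fun_prop))
    exact this hz
  have hm : p + t • (p' - p) ∈ Metric.ball a (r / 2) :=
    (convex_ball a (r / 2)).add_smul_sub_mem hp hp' ht
  rw [mem_ball_iff_norm] at hm hz' ⊢
  calc ‖t • (p' - p) + z - a‖ = ‖(p + t • (p' - p) - a) + (z - p - 0)‖ := by
        congr 1; module
    _ ≤ ‖p + t • (p' - p) - a‖ + ‖z - p - 0‖ := norm_add_le _ _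
    _ < r := by linarith

theorem pairing_neg_left (f g : VectorTest) : pairing (-f) g = -pairing f g := by
  unfold pairing
  rw [← integral_neg]
  exact integral_congr_ae (Eventually.of_forall fun x => inner_neg_left (f x) (g x))

theorem tsupport_add_subset_of_subset {f g : VectorTest} {V : Set E3} (hf : tsupport f ⊆ V)
    (hg : tsupport g ⊆ V) : tsupport (f + g : VectorTest) ⊆ V :=
  (tsupport_add (f : E3 → E3) g).trans (union_subset hf hg)

/-- Small charge densities can be moved from `p` to `p'` by fields supported in `V`. -/
def Transportable (V : Set E3) (p p' : E3) : Prop :=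
  ∃ δ > 0, ∀ ρ : ScalarTest, tsupport ρ ⊆ Metric.ball 0 δ → ∃ c : VectorTest, tsupport c ⊆ V ∧
    ∀ S : ScalarTest, pairing c (grad S) = ∫ x, ρ x * (S (p' + x) - S (p + x))

theorem Transportable.symm {V : Set E3} {p p' : E3} (h : Transportable V p p') :
    Transportable V p' p := by
  obtain ⟨δ, hδ, h⟩ := h
  refine ⟨δ, hδ, fun ρ hρ => ?_⟩
  obtain ⟨c, hc, hS⟩ := h ρ hρ
  refine ⟨-c, ?_, fun S => ?_⟩
  · have : tsupport (-c : VectorTest) = tsupport c := tsupport_neg (c : E3 → E3)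
    rwa [this]
  · rw [pairing_neg_left, hS, ← integral_neg]
    exact integral_congr_ae (Eventually.of_forall fun x => by simp only; ring)

theorem integrable_mul_shift_sub (ρ S : ScalarTest) (p p' : E3) :
    Integrable (fun x => ρ x * (S (p' + x) - S (p + x))) := by
  simp only [mul_sub]
  exact (integrable_mul_shift ρ S p').sub (integrable_mul_shift ρ S p)

theorem Transportable.trans {V : Set E3} {p p' p'' : E3} (h : Transportable V p p')
    (h' : Transportable V p' p'') : Transportable V p p'' := by
  obtain ⟨δ, hδ, h⟩ := h
  obtain ⟨δ', hδ', h'⟩ := h'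
  refine ⟨min δ δ', lt_min hδ hδ', fun ρ hρ => ?_⟩
  obtain ⟨c, hc, hS⟩ := h ρ (hρ.trans (Metric.ball_subset_ball (min_le_left _ _)))
  obtain ⟨c', hc', hS'⟩ := h' ρ (hρ.trans (Metric.ball_subset_ball (min_le_right _ _)))
  refine ⟨c + c', tsupport_add_subset_of_subset hc hc', fun S => ?_⟩
  rw [pairing_add_left, hS, hS', ← integral_add (integrable_mul_shift_sub ρ S p p')
    (integrable_mul_shift_sub ρ S p' p'')]
  exact integral_congr_ae (Eventually.of_forall fun x => by simp only; ring)

/-- Transportability is symmetric (reverse the sign of the field), transitive (add the fields), and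
holds between nearby points by segment fields; connectedness does the rest. -/
theorem transportable_of_isPreconnected {V C : Set E3} (hV : IsOpen V) (hCV : C ⊆ V)
    (hC : IsPreconnected C) {p p' : E3} (hp : p ∈ C) (hp' : p' ∈ C) : Transportable V p p' := by
  refine hC.induction₂ (Transportable V) ?_ (fun _ _ _ _ _ _ h h' => h.trans h')
    (fun _ _ _ _ h => h.symm) hp hp'
  intro a ha
  obtain ⟨r, hr, hball⟩ := Metric.isOpen_iff.1 hV a (hCV ha)
  filter_upwards [nhdsWithin_le_nhds (Metric.ball_mem_nhds a (half_pos hr))] with b hb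
  exact ⟨r / 2, half_pos hr, fun ρ hρ => ⟨segmentField ρ a b,
    (tsupport_segmentField_subset (Metric.mem_ball_self (half_pos hr)) hb hρ).trans hball,
    fun S => pairing_segmentField ρ S a b⟩⟩

/-! ### The divergence theorem for singular cubes -/

theorem inner_cross (w a b : E3) : inner ℝ w (cross a b) =
    w 0 * (a 1 * b 2 - a 2 * b 1) + w 1 * (a 2 * b 0 - a 0 * b 2) +
      w 2 * (a 0 * b 1 - a 1 * b 0) := by
  simp [PiLp.inner_apply, Fin.sum_univ_three, cross, cross_apply]
  ring

/-- The triple product `(a, b) ↦ w · (a × b)` as a continuous bilinear map. -/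
def tripleProduct (w : E3) : E3 →L[ℝ] E3 →L[ℝ] ℝ :=
  (LinearMap.mk₂ ℝ (fun a b : E3 => inner ℝ w (cross a b))
    (fun a a' b => by simp only [inner_cross, PiLp.add_apply]; ring)
    (fun r a b => by simp only [inner_cross, PiLp.smul_apply, smul_eq_mul]; ring)
    (fun a b b' => by simp only [inner_cross, PiLp.add_apply]; ring)
    (fun r a b => by
      simp only [inner_cross, PiLp.smul_apply, smul_eq_mul]; ring)).toContinuousBilinearMap

theorem tripleProduct_apply (w a b : E3) : tripleProduct w a b = inner ℝ w (cross a b) := rfl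

theorem tripleProduct_swap (w a b : E3) : tripleProduct w b a = -tripleProduct w a b := by
  simp only [tripleProduct_apply, inner_cross]
  ring

/-- Cramer's rule for expanding $w$ in $a,b,c$, without the division. It assembles the three partial
derivatives of $\varphi\circ F$ into $\partial_w\varphi$ times the Jacobian. -/
theorem sum_tripleProduct_smul (w a b c : E3) :
    tripleProduct w b c • a + tripleProduct w c a • b + tripleProduct w a b • c =
      inner ℝ a (cross b c) • w := by
  ext i
  simp only [tripleProduct_apply, inner_cross, PiLp.add_apply, PiLp.smul_apply, smul_eq_mul]
  fin_cases i <;> simp <;> ring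

/-- The unit cube. -/
abbrev cube (n : ℕ) : Set (Fin n → ℝ) := Icc 0 1

theorem uniqueDiffOn_cube (n : ℕ) : UniqueDiffOn ℝ (cube n) := by
  rw [cube, ← Set.pi_univ_Icc]
  exact UniqueDiffOn.univ_pi fun _ => uniqueDiffOn_Icc one_pos

theorem interior_cube (n : ℕ) :
    interior (cube n) = Set.pi univ fun _ => Ioo (0 : ℝ) 1 := by
  rw [cube, ← Set.pi_univ_Icc, interior_pi_set finite_univ]
  simp

theorem interior_cube_ae_eq (n : ℕ) : interior (cube n) =ᵐ[volume] cube n := by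
  rw [interior_cube]
  exact Measure.univ_pi_Ioo_ae_eq_Icc (f := (0 : Fin n → ℝ)) (g := 1)

/-- The partial derivative of a map of the closed cube. -/
def partialDeriv (F : (Fin 3 → ℝ) → E3) (k : Fin 3) (u : Fin 3 → ℝ) : E3 :=
  fderivWithin ℝ F (cube 3) u (Pi.single k 1)

/-- The Jacobian determinant of a map of the closed cube. -/
def jacobian (F : (Fin 3 → ℝ) → E3) (u : Fin 3 → ℝ) : ℝ :=
  inner ℝ (partialDeriv F 0 u) (cross (partialDeriv F 1 u) (partialDeriv F 2 u))

/-- The component in direction `w` of the surface element `∂ₖ₊₁F × ∂ₖ₊₂F`. -/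
def surfaceElement (F : (Fin 3 → ℝ) → E3) (w : E3) (k : Fin 3) (u : Fin 3 → ℝ) : ℝ :=
  tripleProduct w (partialDeriv F (k + 1) u) (partialDeriv F (k + 2) u)

section

variable {F : (Fin 3 → ℝ) → E3} (hF : ContDiffOn ℝ ∞ F (cube 3))
include hF

theorem continuousOn_partialDeriv (k : Fin 3) : ContinuousOn (partialDeriv F k) (cube 3) :=
  (hF.continuousOn_fderivWithin (uniqueDiffOn_cube 3) (by simp)).clm_apply continuousOn_const

theorem continuousOn_surfaceElement (w : E3) (k : Fin 3) :
    ContinuousOn (surfaceElement F w k) (cube 3) :=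
  ((tripleProduct w).continuous.comp_continuousOn (continuousOn_partialDeriv hF _)).clm_apply
    (continuousOn_partialDeriv hF _)

theorem continuousOn_jacobian : ContinuousOn (jacobian F) (cube 3) := by
  have hc : ∀ (k i : Fin 3), ContinuousOn (fun u => partialDeriv F k u i) (cube 3) := fun k i =>
    (EuclideanSpace.proj (𝕜 := ℝ) i).continuous.comp_continuousOn (continuousOn_partialDeriv hF k)
  change ContinuousOn (fun u => jacobian F u) _
  simp only [jacobian, inner_cross]
  refine ContinuousOn.add (ContinuousOn.add ?_ ?_) ?_ <;>
  exact (hc _ _).mul (((hc _ _).mul (hc _ _)).sub ((hc _ _).mul (hc _ _)))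

/-- The Piola identity: the surface elements $\partial_{k+1}F\times\partial_{k+2}F$ form a
divergence free field, by symmetry of second derivatives and antisymmetry of the vector product.
Only the derivative of $\varphi$ remains. -/
theorem hasFDerivAt_divergence {φ : E3 → ℝ} (hφ : ContDiff ℝ ∞ φ) (w : E3)
    {u : Fin 3 → ℝ} (hu : u ∈ interior (cube 3)) :
    ∃ f' : Fin 3 → (Fin 3 → ℝ) →L[ℝ] ℝ,
      (∀ k, HasFDerivAt (fun v => φ (F v) * surfaceElement F w k v) (f' k) u) ∧
      ∑ k, f' k (Pi.single k 1) = fderiv ℝ φ (F u) w * jacobian F u := by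
  have hnear : ∀ᶠ v in 𝓝 u, v ∈ interior (cube 3) := isOpen_interior.mem_nhds hu
  have hFat : ContDiffAt ℝ ∞ F u := hF.contDiffAt (mem_interior_iff_mem_nhds.1 hu)
  have hsymm : IsSymmSndFDerivAt ℝ F u := hFat.isSymmSndFDerivAt (by
    rw [minSmoothness_of_isRCLikeNormedField]
    exact WithTop.coe_le_coe.2 (le_top : (2 : ℕ∞) ≤ ⊤))
  have hF1 : HasFDerivAt F (fderiv ℝ F u) u := (hFat.differentiableAt (by simp)).hasFDerivAt
  have hF2 : HasFDerivAt (fderiv ℝ F) (fderiv ℝ (fderiv ℝ F) u) u :=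
    ((hFat.fderiv_right (m := ∞) (by simp)).differentiableAt (by simp)).hasFDerivAt
  set G := fderiv ℝ F u with hG
  set H := fderiv ℝ (fderiv ℝ F) u with hH
  -- The derivative within the cube has to agree with the full one on a neighbourhood, since it is
  -- differentiated again.
  have hpd : ∀ j, partialDeriv F j =ᶠ[𝓝 u] fun v => fderiv ℝ F v (Pi.single j 1) := by
    intro j
    filter_upwards [hnear] with v hv
    rw [partialDeriv, fderivWithin_of_mem_nhds (mem_interior_iff_mem_nhds.1 hv)]
  have hpd0 : ∀ j, partialDeriv F j u = G (Pi.single j 1) := fun j => (hpd j).self_of_nhds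
  have hP : ∀ j, HasFDerivAt (partialDeriv F j) (H.flip (Pi.single j 1)) u := by
    intro j
    refine HasFDerivAt.congr_of_eventuallyEq ?_ (hpd j)
    refine (hF2.clm_apply (hasFDerivAt_const (Pi.single j (1 : ℝ)) u)).congr_fderiv ?_
    ext v
    simp
  have hφF : HasFDerivAt (fun v => φ (F v)) ((fderiv ℝ φ (F u)).comp G) u :=
    ((hφ.differentiable (by simp) _).hasFDerivAt).comp u hF1
  refine ⟨fun k => _, fun k => hφF.mul ((tripleProduct w).hasFDerivAt_of_bilinear
    (hP (k + 1)) (hP (k + 2))), ?_⟩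
  have h01 := hsymm.eq (Pi.single 0 1) (Pi.single 1 1)
  have h02 := hsymm.eq (Pi.single 0 1) (Pi.single 2 1)
  have h12 := hsymm.eq (Pi.single 1 1) (Pi.single 2 1)
  rw [← hH] at h01 h02 h12
  have hw := congrArg (fderiv ℝ φ (F u)) (sum_tripleProduct_smul w (partialDeriv F 0 u)
    (partialDeriv F 1 u) (partialDeriv F 2 u))
  simp only [map_add, map_smul, smul_eq_mul] at hw
  simp only [Fin.sum_univ_three, add_apply, smul_apply, ContinuousLinearMap.precompR_apply,
    ContinuousLinearMap.compL_apply,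
    ContinuousLinearMap.precompL_apply, ContinuousLinearMap.flip_apply, smul_eq_mul,
    ContinuousLinearMap.comp_apply, surfaceElement,
    show (0 : Fin 3) + 1 = 1 from rfl, show (0 : Fin 3) + 2 = 2 from rfl,
    show (1 : Fin 3) + 1 = 2 from rfl, show (1 : Fin 3) + 2 = 0 from rfl,
    show (2 : Fin 3) + 1 = 0 from rfl, show (2 : Fin 3) + 2 = 1 from rfl]
  rw [h01, h02, h12, ← hpd0, ← hpd0, ← hpd0, jacobian, mul_comm (fderiv ℝ φ (F u) w), ← hw]
  -- The six terms with mixed second derivatives cancel in pairs.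
  linear_combination φ (F u) *
    (tripleProduct_swap w (partialDeriv F 1 u) (H (Pi.single 2 1) (Pi.single 0 1)) +
      tripleProduct_swap w (partialDeriv F 2 u) (H (Pi.single 1 1) (Pi.single 0 1)) +
      tripleProduct_swap w (partialDeriv F 0 u) (H (Pi.single 2 1) (Pi.single 1 1)))

theorem integral_divergence_cube {φ : E3 → ℝ} (hφ : ContDiff ℝ ∞ φ) (w : E3) :
    ∫ u in cube 3, fderiv ℝ φ (F u) w * jacobian F u =
      ∑ k : Fin 3, ((∫ x in cube 2, φ (F (k.insertNth 1 x)) *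
          surfaceElement F w k (k.insertNth 1 x)) -
        ∫ x in cube 2, φ (F (k.insertNth 0 x)) * surfaceElement F w k (k.insertNth 0 x)) := by
  classical
  -- Outside the open cube `f'` is arbitrary; the boundary is a null set and does not affect the
  -- integral.
  choose! f' hf' hsum using fun u (hu : u ∈ interior (cube 3)) =>
    hasFDerivAt_divergence hF hφ w hu
  have hc : ContinuousOn (fun u => fderiv ℝ φ (F u) w * jacobian F u) (cube 3) :=
    (((hφ.continuous_fderiv (by simp)).comp_continuousOn hF.continuousOn).clm_apply
      continuousOn_const).mul (continuousOn_jacobian hF)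
  have hae : (fun u => ∑ k, f' u k (Pi.single k 1)) =ᵐ[volume.restrict (cube 3)]
      fun u => fderiv ℝ φ (F u) w * jacobian F u := by
    rw [← Measure.restrict_congr_set (interior_cube_ae_eq 3)]
    exact (ae_restrict_iff' isOpen_interior.measurableSet).2 (Eventually.of_forall hsum)
  rw [← integral_congr_ae hae]
  refine integral_divergence_of_hasFDerivAt_off_countable' (0 : Fin 3 → ℝ) 1 zero_le_one
    (fun k u => φ (F u) * surfaceElement F w k u) (fun k u => f' u k) ∅ countable_empty ?_ ?_ ?_
  · exact fun k => (hφ.continuous.comp_continuousOn hF.continuousOn).mul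
      (continuousOn_surfaceElement hF w k)
  · intro u hu k
    refine hf' u ?_ k
    rw [interior_cube]
    exact hu.1
  · exact (hc.integrableOn_compact isCompact_Icc).congr hae.symm

end

/-- The faces of a singular cube, oriented outwards. -/
def cubePatch {F : (Fin 3 → ℝ) → E3} (hF : ContDiffOn ℝ ∞ F (cube 3)) (k : Fin 3) (top : Bool) :
    Patch where
  toFun := F ∘ face k top
  smooth := hF.comp (contDiff_face k top).contDiffOn (mapsTo_face k top)

/-- The linear part of the parametrisation of a face. -/
def faceLinear (k : Fin 3) (top : Bool) : (Fin 2 → ℝ) →L[ℝ] (Fin 3 → ℝ) :=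
  ContinuousLinearMap.pi fun j =>
    if j = k then 0
    else if j = k + 1 then (if top then .proj 0 else .proj 1)
    else (if top then .proj 1 else .proj 0)

theorem hasFDerivAt_face (k : Fin 3) (top : Bool) (u : Fin 2 → ℝ) :
    HasFDerivAt (face k top) (faceLinear k top) u := by
  refine hasFDerivAt_pi.2 fun j => ?_
  unfold face
  split_ifs
  · exact hasFDerivAt_const _ _
  · exact hasFDerivAt_const _ _
  · exact (ContinuousLinearMap.proj (R := ℝ) (φ := fun _ : Fin 2 => ℝ) 0).hasFDerivAt
  · exact (ContinuousLinearMap.proj (R := ℝ) (φ := fun _ : Fin 2 => ℝ) 1).hasFDerivAt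
  · exact (ContinuousLinearMap.proj (R := ℝ) (φ := fun _ : Fin 2 => ℝ) 1).hasFDerivAt
  · exact (ContinuousLinearMap.proj (R := ℝ) (φ := fun _ : Fin 2 => ℝ) 0).hasFDerivAt

theorem faceLinear_single_zero (k : Fin 3) (top : Bool) :
    faceLinear k top (Pi.single 0 1) = Pi.single (if top then k + 1 else k + 2) 1 := by
  ext j
  fin_cases k <;> fin_cases j <;> cases top <;> simp [faceLinear]

theorem faceLinear_single_one (k : Fin 3) (top : Bool) :
    faceLinear k top (Pi.single 1 1) = Pi.single (if top then k + 2 else k + 1) 1 := by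
  ext j
  fin_cases k <;> fin_cases j <;> cases top <;> simp [faceLinear]

/-- `face` lists the free coordinates cyclically, in reversed order on the bottom face, whereas
`insertNth` lists them increasingly; at most a swap separates the two. -/
theorem exists_perm_face (k : Fin 3) (top : Bool) : ∃ e : Equiv.Perm (Fin 2), ∀ u : Fin 2 → ℝ,
    face k top u = k.insertNth (α := fun _ => ℝ) (if top then 1 else 0) (u ∘ e) := by
  refine ⟨if (k = 1) = (top = true) then Equiv.swap 0 1 else Equiv.refl _, fun u => ?_⟩
  ext j
  fin_cases k <;> cases top <;> fin_cases j <;> simp [face, Fin.insertNth, Fin.succAboveCases]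

theorem integral_cube_comp_perm (e : Equiv.Perm (Fin 2)) (h : (Fin 2 → ℝ) → ℝ) :
    ∫ u in cube 2, h (u ∘ e) = ∫ u in cube 2, h u := by
  have hm := volume_preserving_arrowCongr' e.symm (MeasurableEquiv.refl ℝ) (.id volume)
  have hpre : (MeasurableEquiv.arrowCongr' e.symm (MeasurableEquiv.refl ℝ)) ⁻¹' cube 2 =
      cube 2 := by
    ext u
    constructor
    · intro hu
      have h : ∀ i, MeasurableEquiv.arrowCongr' e.symm (MeasurableEquiv.refl ℝ) u (e.symm i) =
          u i := fun i => congrArg u (e.apply_symm_apply i)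
      exact ⟨fun i => h i ▸ hu.1 (e.symm i), fun i => h i ▸ hu.2 (e.symm i)⟩
    · intro hu
      exact ⟨fun i => hu.1 (e i), fun i => hu.2 (e i)⟩
  have := hm.setIntegral_preimage_emb (MeasurableEquiv.measurableEmbedding _) h (cube 2)
  rw [hpre] at this
  exact this

section

variable {F : (Fin 3 → ℝ) → E3} (hF : ContDiffOn ℝ ∞ F (cube 3))
include hF

/-- On a bottom face the two parameters are exchanged, and antisymmetry of the triple product yields
the sign $-1$ of the outward normal. -/
theorem inner_normal_cubePatch (w : E3) (k : Fin 3) (top : Bool) {u : Fin 2 → ℝ}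
    (hu : u ∈ cube 2) : inner ℝ w ((cubePatch hF k top).normal u) =
      (if top then 1 else -1) * surfaceElement F w k (face k top u) := by
  have h : fderivWithin ℝ (F ∘ face k top) (cube 2) u =
      (fderivWithin ℝ F (cube 3) (face k top u)).comp (faceLinear k top) :=
    (((hF.differentiableOn (by simp)) _ (mapsTo_face k top hu)).hasFDerivWithinAt.comp u
      (hasFDerivAt_face k top u).hasFDerivWithinAt (mapsTo_face k top)).fderivWithin
      (uniqueDiffOn_cube 2 u hu)
  unfold Patch.normal
  simp only [cubePatch]
  rw [h, ContinuousLinearMap.comp_apply, ContinuousLinearMap.comp_apply, faceLinear_single_zero,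
    faceLinear_single_one]
  cases top
  · simp only [Bool.false_eq_true, if_false, neg_one_mul, surfaceElement, partialDeriv]
    rw [← tripleProduct_swap]
    rfl
  · simp only [if_true, one_mul]
    rfl

theorem sum_integral_faces {φ : E3 → ℝ} (hφ : ContDiff ℝ ∞ φ) (w : E3) :
    ∑ k : Fin 3, ∑ top : Bool, ∫ u in cube 2, φ (F (face k top u)) *
        inner ℝ w ((cubePatch hF k top).normal u) =
      ∫ u in cube 3, fderiv ℝ φ (F u) w * jacobian F u := by
  have key : ∀ (k : Fin 3) (top : Bool), ∫ u in cube 2, φ (F (face k top u)) *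
      inner ℝ w ((cubePatch hF k top).normal u) =
      (if top then 1 else -1) * ∫ x in cube 2,
        φ (F (k.insertNth (if top then 1 else 0) x)) *
          surfaceElement F w k (k.insertNth (if top then 1 else 0) x) := by
    intro k top
    obtain ⟨e, he⟩ := exists_perm_face k top
    rw [← integral_cube_comp_perm e fun x => φ (F (k.insertNth (if top then 1 else 0) x)) *
      surfaceElement F w k (k.insertNth (if top then 1 else 0) x), ← integral_const_mul]
    refine setIntegral_congr_fun measurableSet_Icc fun u hu => ?_
    rw [inner_normal_cubePatch hF w k top hu, ← he]
    ring
  rw [integral_divergence_cube hF hφ w]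
  refine Finset.sum_congr rfl fun k _ => ?_
  rw [Fintype.sum_bool, key, key]
  simp [sub_eq_add_neg]

/-- Differentiable maps between spaces of equal dimension preserve null sets. Hence cells may
degenerate or touch along their boundaries without affecting volume integrals. -/
theorem volume_image_boundary : volume (F '' (cube 3 \ interior (cube 3))) = 0 := by
  have h0 : volume (cube 3 \ interior (cube 3)) = 0 :=
    ae_le_set.1 (interior_cube_ae_eq 3).symm.le
  have hd : DifferentiableOn ℝ (WithLp.ofLp ∘ F) (cube 3 \ interior (cube 3)) :=
    ((EuclideanSpace.equiv (Fin 3) ℝ).differentiable.comp_differentiableOn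
      (hF.differentiableOn (by simp))).mono sdiff_subset
  have h1 := addHaar_image_eq_zero_of_differentiableOn_of_addHaar_eq_zero volume hd h0
  have h2 := (PiLp.volume_preserving_toLp (Fin 3)).measure_preimage_emb
    (MeasurableEquiv.toLp 2 (Fin 3 → ℝ)).measurableEmbedding (F '' (cube 3 \ interior (cube 3)))
  rw [← h2]
  convert h1 using 2
  ext x
  constructor
  · rintro ⟨u, hu, hx⟩
    exact ⟨u, hu, by simp [hx]⟩
  · rintro ⟨u, hu, rfl⟩
    exact ⟨u, hu, rfl⟩

theorem image_interior_ae_eq : F '' interior (cube 3) =ᵐ[volume] F '' cube 3 := by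
  refine (image_mono interior_subset).eventuallyLE.antisymm ?_
  refine ae_le_set.2 (measure_mono_null ?_ (volume_image_boundary hF))
  rintro _ ⟨⟨u, hu, rfl⟩, hn⟩
  exact ⟨u, ⟨hu, fun h => hn ⟨u, h, rfl⟩⟩, rfl⟩

theorem integral_image_cube (hinj : InjOn F (interior (cube 3)))
    (hpos : ∀ u ∈ interior (cube 3), 0 < jacobian F u) (h : E3 → ℝ) :
    ∫ y in F '' cube 3, h y = ∫ u in cube 3, h (F u) * jacobian F u := by
  rw [← setIntegral_congr_set (image_interior_ae_eq hF),
    ← setIntegral_congr_set (interior_cube_ae_eq 3)]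
  have h2 := (PiLp.volume_preserving_toLp (Fin 3)).setIntegral_preimage_emb
    (MeasurableEquiv.toLp 2 (Fin 3 → ℝ)).measurableEmbedding h (F '' interior (cube 3))
  have hpre : WithLp.toLp 2 ⁻¹' (F '' interior (cube 3)) =
      (WithLp.ofLp ∘ F) '' interior (cube 3) := by
    ext x
    constructor
    · rintro ⟨u, hu, hx⟩
      exact ⟨u, hu, by simp [hx]⟩
    · rintro ⟨u, hu, rfl⟩
      exact ⟨u, hu, rfl⟩
  have hd : ∀ u ∈ interior (cube 3), HasFDerivWithinAt (WithLp.ofLp ∘ F)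
      ((EuclideanSpace.equiv (Fin 3) ℝ).toContinuousLinearMap.comp (fderivWithin ℝ F (cube 3) u))
      (interior (cube 3)) u := by
    intro u hu
    exact (EuclideanSpace.equiv (Fin 3) ℝ).toContinuousLinearMap.hasFDerivAt.comp_hasFDerivWithinAt
      u (((hF.differentiableOn (by simp)) u (interior_subset hu)).hasFDerivWithinAt.mono
        interior_subset)
  rw [← h2, hpre, integral_image_eq_integral_abs_det_fderiv_smul volume
    isOpen_interior.measurableSet hd ((WithLp.ofLp_injective 2).comp_injOn hinj)]
  refine setIntegral_congr_fun isOpen_interior.measurableSet fun u hu => ?_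
  have hdet : ((EuclideanSpace.equiv (Fin 3) ℝ).toContinuousLinearMap.comp
      (fderivWithin ℝ F (cube 3) u)).det = jacobian F u := by
    rw [ContinuousLinearMap.det, ← LinearMap.det_toMatrix', Matrix.det_fin_three, jacobian,
      inner_cross]
    simp only [LinearMap.toMatrix'_apply, partialDeriv]
    simp
    ring
  simp only [hdet, abs_of_pos (hpos u hu), Function.comp_apply, smul_eq_mul]
  rw [mul_comm]

end

/-! ### Gauss' law -/

theorem inner_patch_surfaceFun (σ : Patch) (s : ScalarTest) (x w : E3) :
    inner ℝ w (σ.surfaceFun s x) =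
      ∫ u in cube 2, s (x - σ.toFun u) * inner ℝ w (σ.normal u) := by
  have hi : IntegrableOn (fun u => s (x - σ.toFun u) • σ.normal u) (cube 2) := by
    refine ContinuousOn.integrableOn_compact isCompact_Icc ?_
    exact (s.continuous.comp_continuousOn (continuousOn_const.sub σ.smooth.continuousOn)).smul
      σ.continuousOn_normal
  change inner ℝ w (∫ u in cube 2, s (x - σ.toFun u) • σ.normal u) = _
  rw [← integral_inner hi]
  simp only [inner_smul_right]

namespace Region

variable (τ : Region)

theorem isCompact_carrier : IsCompact τ.carrier :=
  isCompact_iUnion fun i => isCompact_Icc.image_of_continuousOn (τ.smooth i).continuousOn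

/-- Distinct cells meet only in images of boundary points, which are negligible, so the integral
splits and each cell is a change of variables. -/
theorem integral_carrier {h : E3 → ℝ} (hh : Continuous h) :
    ∫ y in τ.carrier, h y = ∑ i, ∫ u in cube 3, h (τ.cell i u) * jacobian (τ.cell i) u := by
  have hc : ∀ i, IsCompact (τ.cell i '' cube 3) := fun i =>
    isCompact_Icc.image_of_continuousOn (τ.smooth i).continuousOn
  have hjac : ∀ i, ∀ u ∈ interior (cube 3), 0 < jacobian (τ.cell i) u := by
    intro i u hu
    have := τ.oriented i u hu
    simp only [jacobian, partialDeriv]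
    rwa [fderivWithin_of_mem_nhds (mem_interior_iff_mem_nhds.1 hu)]
  have hdis : Pairwise (Function.onFun (AEDisjoint volume) fun i => τ.cell i '' cube 3) := by
    intro i j hij
    refine measure_mono_null ?_ (measure_union_null (volume_image_boundary (τ.smooth i))
      (volume_image_boundary (τ.smooth j)))
    rintro _ ⟨⟨u, hu, rfl⟩, ⟨v, hv, hvu⟩⟩
    by_cases hu' : u ∈ interior (cube 3)
    · by_cases hv' : v ∈ interior (cube 3)
      · exact absurd (τ.injective j i v hv' u hu' hvu).1.symm hij
      · exact Or.inr ⟨v, ⟨hv, hv'⟩, hvu⟩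
    · exact Or.inl ⟨u, ⟨hu, hu'⟩, rfl⟩
  rw [carrier, integral_iUnion_ae (fun i => (hc i).measurableSet.nullMeasurableSet) hdis
    (hh.continuousOn.integrableOn_compact τ.isCompact_carrier), tsum_fintype]
  refine Finset.sum_congr rfl fun i _ => ?_
  exact integral_image_cube (τ.smooth i) (fun u hu v hv h => (τ.injective i i u hu v hv h).2)
    (hjac i) h

/-- The mollified indicator function of the region. -/
def potential (s : ScalarTest) : ScalarTest where
  toFun x := ∫ y in τ.carrier, s (x - y)
  contDiff' := by
    have hs : ContDiff ℝ ∞ (s : E3 → ℝ) := s.contDiff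
    exact contDiff_setIntegral_of_compact volume τ.isCompact_carrier (fun y : E3 => y)
      continuousOn_id (fun z : E3 × E3 => s (z.2 - z.1)) (by fun_prop)
  hasCompactSupport' := by
    refine HasCompactSupport.of_support_subset_isCompact
      (τ.isCompact_carrier.add s.hasCompactSupport.isCompact) fun x hx => ?_
    by_contra hn
    refine hx (setIntegral_eq_zero_of_forall_eq_zero fun y hy => ?_)
    by_contra h
    exact hn ⟨y, hy, x - y, subset_tsupport _ h, by simp⟩
  tsupport_subset' := fun _ _ => trivial

theorem potential_apply (s : ScalarTest) (x : E3) :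
    τ.potential s x = ∫ y in τ.carrier, s (x - y) := rfl

theorem fderiv_potential (s : ScalarTest) (x w : E3) :
    fderiv ℝ (τ.potential s) x w = ∫ y in τ.carrier, fderiv ℝ s (x - y) w := by
  have hs : ContDiff ℝ ∞ (s : E3 → ℝ) := s.contDiff
  have hs' : Continuous (fderiv ℝ s) := hs.continuous_fderiv (by simp)
  obtain ⟨C, hC⟩ := hs'.bounded_above_of_compact_support (s.hasCompactSupport.fderiv ℝ)
  have hint : ∀ {G : Type} [NormedAddCommGroup G] [NormedSpace ℝ G] (h : E3 → G),
      Continuous h → IntegrableOn h τ.carrier := fun h hh =>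
    hh.continuousOn.integrableOn_compact τ.isCompact_carrier
  have hI : IntegrableOn (fun y => fderiv ℝ s (x - y)) τ.carrier :=
    hint _ (hs'.comp (by fun_prop))
  have h : HasFDerivAt (τ.potential s) (∫ y in τ.carrier, fderiv ℝ s (x - y)) x := by
    refine hasFDerivAt_integral_of_dominated_of_fderiv_le (F := fun x y => s (x - y))
      (F' := fun x y => fderiv ℝ s (x - y)) (bound := fun _ => C)
      univ_mem (Eventually.of_forall fun x => (hint _ ?_).aestronglyMeasurable) (hint _ ?_)
      hI.aestronglyMeasurable (Eventually.of_forall fun y x _ => hC _) (hint _ continuous_const)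
      (Eventually.of_forall fun y x _ => ?_)
    · exact s.continuous.comp (by fun_prop)
    · exact s.continuous.comp (by fun_prop)
    · exact ((hs.differentiable (by simp) (x - y)).hasFDerivAt).comp x
        ((hasFDerivAt_id x).sub_const y)
  rw [h.fderiv, ContinuousLinearMap.integral_apply hI]

/-- The divergence theorem on each cell for $\varphi(y)=s(x-y)$, whose gradient in $y$ is minus the
gradient of $s$ at $x-y$. Since all faces of all cells are summed, the cancellation along glued
faces need not be discussed. -/
theorem surfaceFun_eq (s : ScalarTest) : τ.surfaceFun s = -grad (τ.potential s) := by
  have hs : ContDiff ℝ ∞ (s : E3 → ℝ) := s.contDiff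
  have hs' : Continuous (fderiv ℝ s) := hs.continuous_fderiv (by simp)
  ext1 x
  refine ext_inner_left ℝ fun w => ?_
  have hL : inner ℝ w (τ.surfaceFun s x) = ∑ i, ∑ k, ∑ top,
      inner ℝ w ((τ.facePatch i k top).surfaceFun s x) := by
    have : τ.surfaceFun s x = ∑ i, ∑ k, ∑ top, (τ.facePatch i k top).surfaceFun s x := by
      have hsum : ∀ {J : Type} (t : Finset J) (f : J → VectorTest),
          (∑ j ∈ t, f j) x = ∑ j ∈ t, f j x := fun t f =>
        map_sum ((Pi.evalAddMonoidHom (fun _ : E3 => E3) x).comp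
          (FunLike.coeAddMonoidHom VectorTest E3 E3)) f t
      simp only [surfaceFun, hsum]
    rw [this]
    simp only [inner_sum]
  have hR : inner ℝ w ((-grad (τ.potential s) : VectorTest) x) =
      -∫ y in τ.carrier, fderiv ℝ s (x - y) w := by
    rw [← fderiv_potential, ← inner_grad, ← inner_neg_right]
    rfl
  rw [hL, hR, ← integral_neg, τ.integral_carrier (by fun_prop)]
  refine Finset.sum_congr rfl fun i _ => ?_
  have hφ : ContDiff ℝ ∞ (fun y => s (x - y)) := by fun_prop
  have hd : ∀ y, fderiv ℝ (fun y => s (x - y)) y w = -fderiv ℝ s (x - y) w := by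
    intro y
    have h : HasFDerivAt (fun y => s (x - y))
        ((fderiv ℝ s (x - y)).comp (-ContinuousLinearMap.id ℝ E3)) y :=
      ((hs.differentiable (by simp) (x - y)).hasFDerivAt).comp y ((hasFDerivAt_id y).const_sub x)
    rw [h.fderiv]
    simp
  simp only [← hd]
  rw [← sum_integral_faces (τ.smooth i) hφ w]
  refine Finset.sum_congr rfl fun k _ => Finset.sum_congr rfl fun top _ => ?_
  exact inner_patch_surfaceFun _ s x w

/-- A point off the frontier has a ball of radius $r$ inside the region or disjoint from it. With
mollifier and displacement both below $r/2$, the average sees one side only. -/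
theorem eventually_potential {x : E3} (hx : x ∉ τ.surface) : ∃ δ > 0, ∀ s : ScalarTest,
    ∫ y, s y = 1 → tsupport s ⊆ Metric.ball 0 δ →
      (τ.Encloses x → ∀ᶠ z in 𝓝 x, τ.potential s z = 1) ∧
      (¬ τ.Encloses x → ∀ᶠ z in 𝓝 x, τ.potential s z = 0) := by
  have hnear : ∀ {r : ℝ} {s : ScalarTest} {z y : E3}, tsupport s ⊆ Metric.ball 0 (r / 2) →
      z ∈ Metric.ball x (r / 2) → s (z - y) ≠ 0 → y ∈ Metric.ball x r := by
    intro r s z y hs hz h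
    have h1 : ‖z - y‖ < r / 2 := by simpa using hs (subset_tsupport _ h)
    rw [mem_ball_iff_norm] at hz ⊢
    calc ‖y - x‖ = ‖(z - x) - (z - y)‖ := by congr 1; abel
      _ ≤ ‖z - x‖ + ‖z - y‖ := norm_sub_le _ _
      _ < r := by linarith
  by_cases he : x ∈ interior τ.carrier
  · obtain ⟨r, hr, hball⟩ := Metric.isOpen_iff.1 isOpen_interior x he
    refine ⟨r / 2, half_pos hr, fun s h1 hs => ⟨fun _ => ?_, fun h => absurd he h⟩⟩
    filter_upwards [Metric.ball_mem_nhds x (half_pos hr)] with z hz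
    rw [potential_apply, setIntegral_eq_integral_of_forall_compl_eq_zero,
      integral_sub_left_eq_self (fun y => s y), h1]
    intro y hy
    by_contra h
    exact hy (interior_subset (hball (hnear hs hz h)))
  · have hx' : x ∈ τ.carrierᶜ := fun h => hx (by
      rw [surface, τ.isCompact_carrier.isClosed.frontier_eq]
      exact ⟨h, he⟩)
    obtain ⟨r, hr, hball⟩ := Metric.isOpen_iff.1 τ.isCompact_carrier.isClosed.isOpen_compl x hx'
    refine ⟨r / 2, half_pos hr, fun s h1 hs => ⟨fun h => absurd h he, fun _ => ?_⟩⟩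
    filter_upwards [Metric.ball_mem_nhds x (half_pos hr)] with z hz
    refine setIntegral_eq_zero_of_forall_eq_zero fun y hy => ?_
    by_contra h
    exact hball (hnear hs hz h) hy

end Region

theorem notMem_tsupport_grad {S : ScalarTest} {x : E3} {c : ℝ} (h : ∀ᶠ z in 𝓝 x, S z = c) :
    x ∉ tsupport (-grad S : VectorTest) := by
  rw [notMem_tsupport_iff_eventuallyEq]
  filter_upwards [h.eventually_nhds] with z hz
  have h0 : fderiv ℝ S z = 0 := by
    rw [EventuallyEq.fderiv_eq (f := fun _ => c) hz]
    simp
  change -gradient S z = 0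
  simp [gradient, h0]

/-! ### Maps of `ℝ³` which are the identity near infinity are onto -/

/-- The affine parametrisation of the cube `[-L, L]³`. -/
def bigCube (L : ℝ) (u : Fin 3 → ℝ) : E3 :=
  (2 * L) • (EuclideanSpace.equiv (Fin 3) ℝ).symm u - WithLp.toLp 2 fun _ => L

theorem bigCube_apply (L : ℝ) (u : Fin 3 → ℝ) (i : Fin 3) : bigCube L u i = 2 * L * u i - L := by
  simp [bigCube]

theorem contDiff_bigCube (L : ℝ) : ContDiff ℝ ∞ (bigCube L) := by
  unfold bigCube
  exact ((EuclideanSpace.equiv (Fin 3) ℝ).symm.contDiff.const_smul _).sub contDiff_const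

theorem hasFDerivAt_bigCube (L : ℝ) (u : Fin 3 → ℝ) :
    HasFDerivAt (bigCube L)
      ((2 * L) • ((EuclideanSpace.equiv (Fin 3) ℝ).symm : (Fin 3 → ℝ) →L[ℝ] E3)) u :=
  ((EuclideanSpace.equiv (Fin 3) ℝ).symm.hasFDerivAt.const_smul (2 * L)).sub_const _

theorem jacobian_bigCube (L : ℝ) {u : Fin 3 → ℝ} (hu : u ∈ cube 3) :
    jacobian (bigCube L) u = (2 * L) ^ 3 := by
  have h := (hasFDerivAt_bigCube L u).hasFDerivWithinAt.fderivWithin (uniqueDiffOn_cube 3 u hu)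
  simp only [jacobian, partialDeriv, h, inner_cross]
  simp
  ring

theorem norm_coord_le (x : E3) (i : Fin 3) : |x i| ≤ ‖x‖ := by
  simpa using PiLp.norm_apply_le x i

theorem le_norm_bigCube {L : ℝ} {u : Fin 3 → ℝ} {k : Fin 3} (hk : u k = 0 ∨ u k = 1) :
    L ≤ ‖bigCube L u‖ := by
  refine le_trans ?_ (norm_coord_le _ k)
  rw [bigCube_apply]
  rcases hk with h | h <;> rw [h]
  · simpa using neg_le_abs (-L)
  · refine le_trans (le_of_eq ?_) (le_abs_self _)
    ring

theorem mem_bigCube_image {L : ℝ} (hL : 0 < L) {y : E3} (hy : ‖y‖ ≤ L) :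
    y ∈ bigCube L '' cube 3 := by
  refine ⟨fun i => (y i + L) / (2 * L), ⟨fun i => ?_, fun i => ?_⟩, ?_⟩
  · have := abs_le.1 ((norm_coord_le y i).trans hy)
    exact div_nonneg (by linarith) (by linarith)
  · have := abs_le.1 ((norm_coord_le y i).trans hy)
    exact (div_le_one (by linarith)).2 (by linarith)
  · ext i
    rw [bigCube_apply]
    field_simp
    ring

theorem injective_bigCube {L : ℝ} (hL : 0 < L) : Function.Injective (bigCube L) := by
  intro u v h
  ext i
  have := congrArg (fun x : E3 => x i) h
  simp only [bigCube_apply] at this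
  have h2 : 2 * L * u i = 2 * L * v i := by linarith
  exact mul_left_cancel₀ (by positivity) h2

theorem jacobian_congr {F G : (Fin 3 → ℝ) → E3} {u : Fin 3 → ℝ} (h : F =ᶠ[𝓝 u] G) :
    jacobian F u = jacobian G u := by
  simp only [jacobian, partialDeriv]
  rw [(h.filter_mono nhdsWithin_le_nhds).fderivWithin_eq h.self_of_nhds]

/-- A degree argument in integral form. If $F$ stays away from $a$, take a bump $\rho$ at $a$ and a
long vector $v$. The density $\rho-\rho(\cdot-v)$ is the $v$-derivative of a compactly supported
tube, so its pullback under $F$ integrates to zero. But the pullback of $\rho$ vanishes, and near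
the support of $\rho(\cdot-v)$ the map is the identity, which leaves $-\int\rho\neq0$. -/
theorem exists_near_of_contDiff {F : E3 → E3} (hF : ContDiff ℝ ∞ F) {r : ℝ}
    (hid : ∀ x, r ≤ ‖x‖ → F x = x) (a : E3) {η : ℝ} (hη : 0 < η) : ∃ x, ‖F x - a‖ < η := by
  by_contra! hav
  let B : ContDiffBump a := ⟨η / 4, η / 2, by positivity, by linarith⟩
  let ρ : ScalarTest :=
    { toFun := B
      contDiff' := B.contDiff
      hasCompactSupport' := B.hasCompactSupport
      tsupport_subset' := fun _ _ => trivial }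
  have hρ0 : ∀ y, η ≤ ‖y - a‖ → ρ y = 0 := fun y hy =>
    B.zero_of_le_dist (by rw [dist_eq_norm]; change η / 2 ≤ _; linarith)
  obtain ⟨M, hM⟩ := (isCompact_closedBall (0 : E3) r).exists_bound_of_continuousOn
    hF.continuous.continuousOn
  -- So long that $\rho(\cdot-v)$ vanishes both on the ball of radius $r$ and on its image under
  -- $F$.
  obtain ⟨v, hv⟩ := NormedSpace.exists_lt_norm ℝ E3 (|r| + |M| + ‖a‖ + η)
  have hfar : ∀ y : E3, ‖y‖ ≤ |r| + |M| → ρ (y - v) = 0 := by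
    intro y hy
    refine hρ0 _ ?_
    have h1 : ‖v‖ ≤ ‖y - v - a‖ + (‖y‖ + ‖a‖) := by
      calc ‖v‖ = ‖(y - a) - (y - v - a)‖ := by congr 1; abel
        _ ≤ ‖y - a‖ + ‖y - v - a‖ := norm_sub_le _ _
        _ ≤ _ := by linarith [norm_sub_le y a]
    linarith
  obtain ⟨b, hb⟩ := (tube ρ v).hasCompactSupport.isCompact.isBounded.subset_closedBall 0
  -- On the boundary of the cube $F$ must be the identity (from $|r|$) and the tube must vanish
  -- (from $|b|$); the bracket makes the cube contain the support of $\rho(\cdot-v)$.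
  set L : ℝ := |r| + |b| + (‖v‖ + ‖a‖ + η) + 1 with hLdef
  have hL : 0 < L := by positivity
  have hG : ContDiffOn ℝ ∞ (F ∘ bigCube L) (cube 3) := (hF.comp (contDiff_bigCube L)).contDiffOn
  have hface : ∀ u : Fin 3 → ℝ, ∀ k, u k = 0 ∨ u k = 1 → tube ρ v ((F ∘ bigCube L) u) = 0 := by
    intro u k hk
    have h1 := le_norm_bigCube (L := L) hk
    have h2 : r ≤ ‖bigCube L u‖ := by
      refine le_trans ((le_abs_self r).trans ?_) h1
      rw [hLdef]
      have := norm_nonneg v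
      have := norm_nonneg a
      have := abs_nonneg b
      linarith
    rw [Function.comp_apply, hid _ h2]
    refine image_eq_zero_of_notMem_tsupport fun hmem => ?_
    have h3 : ‖bigCube L u‖ ≤ b := by simpa using hb hmem
    have := norm_nonneg v
    have := norm_nonneg a
    have := abs_nonneg r
    have := le_abs_self b
    linarith
  have hdiv := integral_divergence_cube hG (tube ρ v).contDiff v
  have hzero : ∫ u in cube 3, fderiv ℝ (tube ρ v) ((F ∘ bigCube L) u) v *
      jacobian (F ∘ bigCube L) u = 0 := by
    rw [hdiv]
    refine Finset.sum_eq_zero fun k _ => ?_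
    have e1 : ∀ x : Fin 2 → ℝ, tube ρ v ((F ∘ bigCube L) (k.insertNth 1 x)) = 0 := fun x =>
      hface _ k (by simp)
    have e0 : ∀ x : Fin 2 → ℝ, tube ρ v ((F ∘ bigCube L) (k.insertNth 0 x)) = 0 := fun x =>
      hface _ k (by simp)
    simp only [e1, e0, zero_mul, integral_zero, sub_self]
  have hint : ∀ u, fderiv ℝ (tube ρ v) ((F ∘ bigCube L) u) v * jacobian (F ∘ bigCube L) u =
      -(ρ (bigCube L u - v) * jacobian (bigCube L) u) := by
    intro u
    rw [fderiv_tube, hρ0 ((F ∘ bigCube L) u) (hav (bigCube L u)), zero_sub, neg_mul, neg_inj]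
    by_cases hr : ‖bigCube L u‖ ≤ r
    · have h1 : ‖F (bigCube L u)‖ ≤ M := hM _ (by simpa using hr)
      rw [Function.comp_apply, hfar _ (by linarith [le_abs_self M, abs_nonneg r]),
        hfar _ (by linarith [le_abs_self r, abs_nonneg M]), zero_mul, zero_mul]
    · have hev : F ∘ bigCube L =ᶠ[𝓝 u] bigCube L := by
        have : ∀ᶠ u' in 𝓝 u, r < ‖bigCube L u'‖ :=
          (contDiff_bigCube L).continuous.norm.continuousAt.eventually (lt_mem_nhds (not_le.1 hr))
        filter_upwards [this] with u' hu'
        exact hid _ hu'.le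
      rw [jacobian_congr hev, hev.self_of_nhds]
  simp only [hint] at hzero
  rw [integral_neg, neg_eq_zero, ← integral_image_cube (contDiff_bigCube L).contDiffOn
    (injective_bigCube hL).injOn
    (fun u hu => by rw [jacobian_bigCube L (interior_subset hu)]; positivity)
    (fun y => ρ (y - v)), setIntegral_eq_integral_of_forall_compl_eq_zero,
    integral_sub_right_eq_self (fun y => ρ y)] at hzero
  · exact (B.integral_pos (μ := volume)).ne' hzero
  · intro y hy
    refine hρ0 _ ?_
    by_contra! h
    refine hy (mem_bigCube_image hL ?_)
    have : ‖y‖ ≤ ‖y - v - a‖ + (‖v‖ + ‖a‖) := by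
      calc ‖y‖ = ‖(y - v - a) + (v + a)‖ := by congr 1; abel
        _ ≤ ‖y - v - a‖ + ‖v + a‖ := norm_add_le _ _
        _ ≤ _ := by linarith [norm_add_le v a]
    have := abs_nonneg r
    have := abs_nonneg b
    linarith

/-- A compact part and the identity far out keep $f$ at a positive distance $\eta$ from an omitted
point. A smooth map within $\eta/2$ of $f$, still the identity far out, would then contradict
`exists_near_of_contDiff`. -/
theorem surjective_of_continuous_of_eq_id {f : E3 → E3} (hf : Continuous f) {r : ℝ}
    (hid : ∀ x, r ≤ ‖x‖ → f x = x) : Function.Surjective f := by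
  intro a
  by_contra! hav
  set R : ℝ := |r| + ‖a‖ + 1 with hR
  have hRpos : 0 < R := by positivity
  have hrR : r ≤ R := by linarith [le_abs_self r, norm_nonneg a]
  obtain ⟨η, hη, hlow⟩ : ∃ η > 0, ∀ x, η ≤ ‖f x - a‖ := by
    obtain ⟨x₀, -, hx₀⟩ := (isCompact_closedBall (0 : E3) R).exists_isMinOn
      ⟨0, by simpa using hRpos.le⟩ (f := fun x => ‖f x - a‖) (by fun_prop)
    refine ⟨min ‖f x₀ - a‖ 1, lt_min (norm_pos_iff.2 (sub_ne_zero.2 (hav x₀))) one_pos,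
      fun x => ?_⟩
    by_cases hx : ‖x‖ ≤ R
    · exact (min_le_left _ _).trans (hx₀ (by simpa using hx))
    · refine (min_le_right _ _).trans ?_
      rw [hid x (by linarith)]
      linarith [norm_sub_norm_le x a, abs_nonneg r]
  have hcs : HasCompactSupport (fun x => f x - x) := by
    refine HasCompactSupport.of_support_subset_isCompact (isCompact_closedBall (0 : E3) R) ?_
    intro x hx
    by_contra h
    have : R < ‖x‖ := by simpa using h
    exact hx (sub_eq_zero.2 (hid x (by linarith)))
  have huc : UniformContinuous (fun x => f x - x) :=
    (hf.sub continuous_id).uniformContinuous_of_tendsto_cocompact hcs.is_zero_at_infty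
  obtain ⟨g, hg, hgd⟩ := huc.exists_contDiff_dist_le (half_pos hη)
  -- The approximation of $f-\mathrm{id}$ is cut off where $f$ is already the identity, which does
  -- not increase the error.
  let χ : ContDiffBump (0 : E3) := ⟨R, R + 1, hRpos, by linarith⟩
  obtain ⟨x, hx⟩ := exists_near_of_contDiff (F := fun x => x + χ x • g x)
    (contDiff_id.add (χ.contDiff.smul hg)) (r := R + 1) (fun x hx => by
      have : χ x = 0 := χ.zero_of_le_dist (by simpa using hx)
      simp [this]) a (half_pos hη)
  have hdiff : ‖χ x • g x - (f x - x)‖ < η / 2 := by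
    have h1 : ‖g x - (f x - x)‖ < η / 2 := by simpa [dist_eq_norm] using hgd x
    by_cases hxR : ‖x‖ ≤ R
    · have : χ x = 1 := χ.one_of_mem_closedBall (by simpa using hxR)
      rwa [this, one_smul]
    · rw [hid x (by linarith), sub_self, sub_zero] at h1 ⊢
      rw [norm_smul, Real.norm_of_nonneg χ.nonneg]
      exact (mul_le_of_le_one_left (norm_nonneg _) χ.le_one).trans_lt h1
  have : ‖f x - a‖ < η := by
    calc ‖f x - a‖ = ‖(x + χ x • g x - a) - (χ x • g x - (f x - x))‖ := by congr 1; abel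
      _ ≤ ‖x + χ x • g x - a‖ + ‖χ x • g x - (f x - x)‖ := norm_sub_le _ _
      _ < η := by linarith
  exact absurd (hlow x) (not_le.2 this)

/-! ### Compact sets which are contractible in the complement of a point -/

/-- A map of a compact set which avoids `a`, and is contractible within the complement of `a`,
extends to a map of the whole space which avoids `a`. -/
theorem exists_extension_avoiding {K : Set E3} (hK : IsCompact K) {a c : E3} (hc : c ≠ a)
    (H : C(unitInterval × K, E3)) (h0 : ∀ x : K, H (0, x) = x) (h1 : ∀ x : K, H (1, x) = c)
    (ha : ∀ z, H z ≠ a) :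
    ∃ F : E3 → E3, Continuous F ∧ (∀ x ∈ K, F x = x) ∧ ∀ x, F x ≠ a := by
  have hemb : IsClosedEmbedding (Prod.map id Subtype.val : unitInterval × K → unitInterval × E3) :=
    IsClosedEmbedding.id.prodMap hK.isClosed.isClosedEmbedding_subtypeVal
  obtain ⟨G, hG⟩ := H.exists_extension hemb
  have hGH : ∀ t (x : K), G (t, x) = H (t, x) := fun t x =>
    congrArg (fun f : C(unitInterval × K, E3) => f (t, x)) hG
  -- The Tietze extension is corrected so that it is constantly $c$ at time $1$ on all of space; on
  -- $K$ the correction is zero.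
  let G' : unitInterval × E3 → E3 := fun z => G z + (z.1 : ℝ) • (c - G (1, z.2))
  have hG' : Continuous G' := by fun_prop
  have hG'K : ∀ t (x : K), G' (t, x) = H (t, x) := by
    intro t x
    simp only [G', hGH, h1, sub_self, smul_zero, add_zero]
  have hG'1 : ∀ x, G' (1, x) = c := by
    intro x
    simp [G']
  -- The points whose track under `G'` hits $a$ at some time; closed because the time interval is
  -- compact.
  have hZ : IsClosed (Prod.snd '' (G' ⁻¹' {a})) :=
    isClosedMap_snd_of_compactSpace _ (isClosed_singleton.preimage hG')
  have hdis : Disjoint K (Prod.snd '' (G' ⁻¹' {a})) := by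
    rw [Set.disjoint_left]
    rintro x hx ⟨⟨t, y⟩, hy, rfl⟩
    refine ha (t, ⟨y, hx⟩) ?_
    rw [← hG'K]
    exact hy
  -- Running the homotopy up to time $\varphi(x)$ gives the identity on $K$, gives $c$ on the bad
  -- set, and cannot reach $a$ elsewhere.
  obtain ⟨φ, hφ0, hφ1, hφ⟩ := exists_continuous_zero_one_of_isClosed hK.isClosed hZ hdis
  refine ⟨fun x => G' (⟨φ x, hφ x⟩, x), ?_, fun x hx => ?_, fun x hx => ?_⟩
  · exact hG'.comp ((φ.continuous.subtype_mk hφ).prodMk continuous_id)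
  · have : (⟨φ x, hφ x⟩ : unitInterval) = 0 := Subtype.ext (hφ0 hx)
    simp only [this]
    exact (hG'K 0 ⟨x, hx⟩).trans (h0 ⟨x, hx⟩)
  · have hx1 : (⟨φ x, hφ x⟩ : unitInterval) = 1 := Subtype.ext (hφ1 ⟨_, hx, rfl⟩)
    simp only [hx1, hG'1] at hx
    exact hc hx

/-- The components of the open set $K^c$ are open, so a frontier point outside $K$ would have a
component meeting, hence equal to, the given one, and would be interior to it. -/
theorem frontier_connectedComponentIn_subset {K : Set E3} (hK : IsClosed K) (a : E3) :
    frontier (connectedComponentIn Kᶜ a) ⊆ K := by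
  intro y hy
  by_contra hyK
  have hopen : ∀ z, IsOpen (connectedComponentIn Kᶜ z) := fun z =>
    hK.isOpen_compl.connectedComponentIn
  have hcl := frontier_subset_closure hy
  obtain ⟨z, hz, hz'⟩ := mem_closure_iff.1 hcl _ (hopen y) (mem_connectedComponentIn hyK)
  have e : connectedComponentIn Kᶜ a = connectedComponentIn Kᶜ y :=
    (connectedComponentIn_eq hz').trans (connectedComponentIn_eq hz).symm
  rw [(hopen a).frontier_eq] at hy
  exact hy.2 (e ▸ mem_connectedComponentIn hyK)

/-- If a compact set is contractible in the complement of `a`, then `a` lies in an unbounded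
component of its complement. -/
theorem not_isBounded_connectedComponentIn {K : Set E3} (hK : IsCompact K) {a c : E3} (hc : c ≠ a)
    (haK : a ∉ K)
    (H : C(unitInterval × K, E3)) (h0 : ∀ x : K, H (0, x) = x) (h1 : ∀ x : K, H (1, x) = c)
    (ha : ∀ z, H z ≠ a) : ¬ Bornology.IsBounded (connectedComponentIn Kᶜ a) := by
  classical
  intro hb
  obtain ⟨F, hF, hFK, hFa⟩ := exists_extension_avoiding hK hc H h0 h1 ha
  obtain ⟨r, hr⟩ := hb.subset_ball 0
  -- `F` on the bounded component and the identity elsewhere agree on the frontier, which lies in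
  -- $K$. The glued map omits $a$ and is the identity far out.
  have hcont : Continuous fun x => if x ∈ connectedComponentIn Kᶜ a then F x else x :=
    Continuous.if (fun x hx => hFK x (frontier_connectedComponentIn_subset hK.isClosed a hx)) hF
      continuous_id
  obtain ⟨x, hx⟩ := surjective_of_continuous_of_eq_id hcont (r := r) (fun x hx => if_neg fun h => by
    have : ‖x‖ < r := by simpa using hr h
    linarith) a
  beta_reduce at hx
  by_cases hxC : x ∈ connectedComponentIn Kᶜ a
  · rw [if_pos hxC] at hx
    exact hFa x hx
  · rw [if_neg hxC] at hx
    exact hxC (by rw [hx]; exact mem_connectedComponentIn haK)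

theorem isPreconnected_norm_gt {R : ℝ} (hR : 0 ≤ R) : IsPreconnected {x : E3 | R < ‖x‖} := by
  have hs : IsPreconnected (Metric.sphere (0 : E3) 1) := by
    refine isPreconnected_sphere ?_ 0 1
    rw [← Module.finrank_eq_rank, finrank_euclideanSpace_fin]
    norm_num
  have := (isPreconnected_Ioi (a := R)).prod hs
  have h2 := this.image (fun z : ℝ × E3 => z.1 • z.2) (by fun_prop)
  convert h2 using 1
  ext x
  constructor
  · intro hx
    have hx0 : ‖x‖ ≠ 0 := (hR.trans_lt hx).ne'
    exact ⟨(‖x‖, ‖x‖⁻¹ • x), ⟨hx, by simp [norm_smul, hx0]⟩, by simp [smul_smul, hx0]⟩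
  · rintro ⟨⟨t, y⟩, ⟨ht, hy⟩, rfl⟩
    have ht' : R < t := ht
    have hy' : ‖y‖ = 1 := by simpa using hy
    change R < ‖t • y‖
    rw [norm_smul, hy', mul_one, Real.norm_eq_abs]
    exact ht'.trans_le (le_abs_self t)

/-- Both unbounded components meet the exterior of a large ball, which is connected and disjoint
from $K$. -/
theorem connectedComponentIn_eq_of_not_isBounded {K : Set E3} (hK : IsCompact K) {a b : E3}
    (ha : ¬ Bornology.IsBounded (connectedComponentIn Kᶜ a))
    (hb : ¬ Bornology.IsBounded (connectedComponentIn Kᶜ b)) :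
    connectedComponentIn Kᶜ a = connectedComponentIn Kᶜ b := by
  obtain ⟨R, hR, hKR⟩ := hK.isBounded.subset_closedBall_lt 0 0
  have hsub : {x : E3 | R < ‖x‖} ⊆ Kᶜ := fun x hx hxK => by
    have : ‖x‖ ≤ R := by simpa using hKR hxK
    exact absurd hx (not_lt.2 this)
  have key : ∀ a : E3, ¬ Bornology.IsBounded (connectedComponentIn Kᶜ a) →
      ∃ z ∈ connectedComponentIn Kᶜ a, R < ‖z‖ := by
    intro a ha
    by_contra! h
    exact ha ((Metric.isBounded_closedBall (x := (0 : E3)) (r := R)).subset fun z hz =>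
      mem_closedBall_zero_iff.2 (h z hz))
  obtain ⟨z, hz, hzR⟩ := key a ha
  obtain ⟨w, hw, hwR⟩ := key b hb
  have h : w ∈ connectedComponentIn Kᶜ z :=
    (isPreconnected_norm_gt hR.le).subset_connectedComponentIn hzR hsub hwR
  rw [connectedComponentIn_eq hz, connectedComponentIn_eq hw, connectedComponentIn_eq h]

/-! ### Closing a bridge off a compact set -/

/-- The rescaled density `x ↦ k⁻³ ρ(x / k)`. -/
def rescale (ρ : ScalarTest) {k : ℝ} (hk : 0 < k) : ScalarTest where
  toFun x := (k⁻¹) ^ 3 * ρ (k⁻¹ • x)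
  contDiff' := by
    have : ContDiff ℝ ∞ (ρ : E3 → ℝ) := ρ.contDiff
    fun_prop
  hasCompactSupport' := by
    have h : HasCompactSupport fun x => ρ (k⁻¹ • x) :=
      ρ.hasCompactSupport.comp_smul (inv_ne_zero hk.ne')
    exact h.mul_left (f := fun _ => (k⁻¹) ^ 3)
  tsupport_subset' := fun _ _ => trivial

theorem rescale_apply (ρ : ScalarTest) {k : ℝ} (hk : 0 < k) (x : E3) :
    rescale ρ hk x = (k⁻¹) ^ 3 * ρ (k⁻¹ • x) := rfl

theorem integral_rescale_mul (ρ : ScalarTest) {k : ℝ} (hk : 0 < k) (h : E3 → ℝ) :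
    ∫ x, rescale ρ hk x * h x = ∫ y, ρ y * h (k • y) := by
  have := Measure.integral_comp_inv_smul_of_nonneg (volume : Measure E3)
    (fun y => (k⁻¹) ^ 3 * (ρ y * h (k • y))) hk.le
  rw [integral_const_mul (_ ^ 3) (fun y => ρ y * h (k • y)), finrank_euclideanSpace_fin,
    smul_eq_mul, ← mul_assoc, ← mul_pow, mul_inv_cancel₀ hk.ne', one_pow, one_mul] at this
  rw [← this]
  refine integral_congr_ae (Eventually.of_forall fun x => ?_)
  simp only [rescale_apply, smul_smul, mul_inv_cancel₀ hk.ne', one_smul, mul_assoc]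

theorem tsupport_rescale_subset {ρ : ScalarTest} {k R δ : ℝ} (hk : 0 < k)
    (hρ : tsupport ρ ⊆ Metric.ball 0 R) (h : k * R ≤ δ) :
    tsupport (rescale ρ hk) ⊆ Metric.ball 0 δ := by
  have h1 : tsupport (rescale ρ hk) ⊆ (fun x => k⁻¹ • x) ⁻¹' tsupport ρ :=
    closure_minimal (fun x hx => subset_tsupport _ fun h0 => hx (by simp [rescale_apply, h0]))
      ((isClosed_tsupport _).preimage (by fun_prop))
  intro x hx
  have h2 : ‖k⁻¹ • x‖ < R := by simpa using hρ (h1 hx)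
  rw [norm_smul, norm_inv, Real.norm_of_nonneg hk.le, inv_mul_lt_iff₀ hk] at h2
  simpa using h2.trans_le h

theorem pairing_eq_zero_of_disjoint {f g : VectorTest} {K : Set E3} (hf : tsupport f ⊆ Kᶜ)
    (hg : tsupport g ⊆ K) : pairing f g = 0 := by
  refine integral_eq_zero_of_ae (Eventually.of_forall fun x => ?_)
  by_cases hx : x ∈ K
  · simp [image_eq_zero_of_notMem_tsupport fun h => hf h hx]
  · simp [image_eq_zero_of_notMem_tsupport fun h => hx (hg h)]

/-- The cut off bridge moves a density $\rho$ from $\gamma(\varepsilon)$ to $\gamma(1-\varepsilon)$.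
Three return legs off $K$, through $x_2$ and $x_1$, close it into a divergence free field and are
invisible to fields supported in $K$. -/
theorem BridgeData.exists_divergenceFree {x₁ x₂ : E3} {q : ℝ} (D : BridgeData x₁ x₂ q) {K : Set E3}
    (hK : IsClosed K) (h₁ : x₁ ∉ K) (h₂ : x₂ ∉ K) (hT : Transportable Kᶜ x₂ x₁) :
    ∃ b : VectorTest, (∀ S, pairing b (grad S) = 0) ∧
      ∀ g : VectorTest, tsupport g ⊆ K → pairing b g = D.fluxFunctional g := by
  obtain ⟨δ, hδ, hT⟩ := hT
  obtain ⟨r₁, hr₁, hball₁⟩ := Metric.isOpen_iff.1 hK.isOpen_compl x₁ h₁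
  obtain ⟨r₂, hr₂, hball₂⟩ := Metric.isOpen_iff.1 hK.isOpen_compl x₂ h₂
  obtain ⟨ε, hcut, hε, hp₁, hp₂, hw, hw₁, hw₂⟩ :=
    ((D.eventually_pairing_cutoff_eq hK h₁ h₂).and
      ((eventually_mem_set.2 (Ioo_mem_nhdsGT (one_half_pos (α := ℝ)))).and
      ((D.tendsto_path_source.eventually_mem (Metric.ball_mem_nhds x₁ (half_pos hr₁))).and
      ((D.tendsto_path_target.eventually_mem (Metric.ball_mem_nhds x₂ (half_pos hr₂))).and
      ((D.tendsto_width.eventually_lt_const hδ).and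
      ((D.tendsto_width.eventually_lt_const (half_pos hr₁)).and
        (D.tendsto_width.eventually_lt_const (half_pos hr₂)))))))).exists
  have hk : 0 < ε * (1 - ε) := mul_pos hε.1 (by linarith [hε.2])
  rw [abs_of_pos hk] at hw hw₁ hw₂
  -- The same density sits at both ends because $u(1-u)$ takes equal values at $\varepsilon$ and
  -- $1-\varepsilon$.
  set ρ := rescale D.profile hk with hρ
  obtain ⟨c, hc, hcS⟩ := hT ρ (tsupport_rescale_subset hk D.profile_support hw.le)
  have hc₁ : tsupport (segmentField ρ x₁ (D.path ε)) ⊆ Kᶜ :=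
    (tsupport_segmentField_subset (Metric.mem_ball_self (half_pos hr₁)) hp₁
      (tsupport_rescale_subset hk D.profile_support hw₁.le)).trans hball₁
  have hc₂ : tsupport (segmentField ρ (D.path (1 - ε)) x₂) ⊆ Kᶜ :=
    (tsupport_segmentField_subset hp₂ (Metric.mem_ball_self (half_pos hr₂))
      (tsupport_rescale_subset hk D.profile_support hw₂.le)).trans hball₂
  refine ⟨D.cutoff ε + (segmentField ρ (D.path (1 - ε)) x₂ +
    (c + segmentField ρ x₁ (D.path ε))), fun S => ?_, fun g hg => ?_⟩
  · have hcutS : pairing (D.cutoff ε) (grad S) =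
        ∫ x, ρ x * (S (D.path (1 - ε) + x) - S (D.path ε + x)) := by
      rw [D.pairing_cutoff_grad hε.1 hε.2.le, integral_rescale_mul]
      refine integral_congr_ae (Eventually.of_forall fun y => ?_)
      simp only [BridgeData.pathAt, sub_sub_cancel, mul_comm (1 - ε) ε]
    have hi : ∀ p p' : E3, ∫ x, ρ x * (S (p' + x) - S (p + x)) =
        (∫ x, ρ x * S (p' + x)) - ∫ x, ρ x * S (p + x) := fun p p' => by
      simp only [mul_sub]
      exact integral_sub (integrable_mul_shift ρ S p') (integrable_mul_shift ρ S p)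
    rw [pairing_add_left, pairing_add_left, pairing_add_left, hcutS, hcS, pairing_segmentField,
      pairing_segmentField, hi, hi, hi, hi]
    ring
  · rw [pairing_add_left, pairing_eq_zero_of_disjoint (tsupport_add_subset_of_subset hc₂
      (tsupport_add_subset_of_subset hc hc₁)) hg, add_zero, hcut g hg]

/-- If `K` is contractible in the complement of `x₁` and `x₂`, then small charge densities can be
moved from `x₂` to `x₁` off `K`. -/
theorem transportable_of_nullhomotopic {x₁ x₂ : E3} {K : Set E3} (hK : IsCompact K)
    (hO : K ⊆ awayFrom x₁ x₂) (hnull : (ContinuousMap.inclusion hO).Nullhomotopic) :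
    Transportable Kᶜ x₂ x₁ := by
  obtain ⟨c, ⟨H⟩⟩ := hnull
  have hne : ∀ y : ↥(awayFrom x₁ x₂ : Set E3), (y : E3) ≠ x₁ ∧ (y : E3) ≠ x₂ := by
    rintro ⟨y, hy⟩
    exact ⟨fun h => hy (Or.inl h), fun h => hy (Or.inr h)⟩
  have h₁ : x₁ ∉ K := fun h => (hne ⟨x₁, hO h⟩).1 rfl
  have h₂ : x₂ ∉ K := fun h => (hne ⟨x₂, hO h⟩).2 rfl
  let H' : C(unitInterval × K, E3) := ⟨fun z => (H z : E3), by fun_prop⟩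
  have h0 : ∀ x : K, H' (0, x) = x := fun x => congrArg Subtype.val (H.apply_zero x)
  have h1 : ∀ x : K, H' (1, x) = c := fun x => congrArg Subtype.val (H.apply_one x)
  -- The same contraction avoids both charges, so it puts each of them in an unbounded component.
  have e := connectedComponentIn_eq_of_not_isBounded hK
    (not_isBounded_connectedComponentIn hK (hne c).1 h₁ H' h0 h1 fun z => (hne (H z)).1)
    (not_isBounded_connectedComponentIn hK (hne c).2 h₂ H' h0 h1 fun z => (hne (H z)).2)
  refine transportable_of_isPreconnected hK.isClosed.isOpen_compl
    (connectedComponentIn_subset _ x₁) isPreconnected_connectedComponentIn ?_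
    (mem_connectedComponentIn h₁)
  rw [e]
  exact mem_connectedComponentIn h₂

/-! ### Gauge bridges and charged states -/

/-- A divergence free $b$ has trivial Weyl phase with every gradient; this is gauge invariance. -/
theorem expA_mem_observables {b : VectorTest} (hb : ∀ S, pairing b (grad S) = 0) :
    expA b ∈ observables ⊤ := by
  refine ⟨expA_mem_weylAlgebra fun _ _ => trivial, (StarSubalgebra.mem_centralizer_iff ℂ).2 ?_⟩
  have key : ∀ g, pairing b g = 0 → expE g * expA b = expA b * expE g := by
    intro g hg
    rw [weyl_relation, hg]
    simp
  rintro W ⟨S, rfl⟩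
  rw [star_expE]
  exact ⟨key _ (hb S), key _ (by rw [pairing_neg_right, hb, neg_zero])⟩

/-! ### Vectors in the GNS representation -/

theorem inner_gnsStarAlgHom {𝔅 : Type*} [CStarAlgebra 𝔅] [PartialOrder 𝔅] [StarOrderedRing 𝔅]
    (ω₀ : 𝔅 →ₚ[ℂ] ℂ) (W A : 𝔅) :
    inner ℂ (ω₀.toPreGNS W : ω₀.GNS) (ω₀.gnsStarAlgHom A (ω₀.toPreGNS W : ω₀.GNS)) =
      ω₀ (star W * (A * W)) := by
  change inner ℂ _ (ω₀.gnsNonUnitalStarAlgHom A _) = _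
  rw [PositiveLinearMap.gnsNonUnitalStarAlgHom_apply_coe,
    UniformSpace.Completion.inner_coe, PositiveLinearMap.preGNS_inner_def]
  simp

theorem norm_toPreGNS {𝔅 : Type*} [CStarAlgebra 𝔅] [PartialOrder 𝔅] [StarOrderedRing 𝔅]
    (ω₀ : 𝔅 →ₚ[ℂ] ℂ) (hone : ω₀ 1 = 1) {W : 𝔅} (hW : star W * W = 1) :
    ‖(ω₀.toPreGNS W : ω₀.GNS)‖ = 1 := by
  rw [UniformSpace.Completion.norm_coe, PositiveLinearMap.preGNS_norm_def]
  simp [hW, hone]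

namespace BridgeData

variable {x₁ x₂ : E3} {q : ℝ} (D : BridgeData x₁ x₂ q)

/-- The gauge bridge as an automorphism of the algebra of all bounded operators. -/
def bridgeAut : Op ≃⋆ₐ[ℂ] Op := Unitary.conjStarAlgAut ℂ Op (unitaryPhase D.fluxFunctional)

theorem isPhaseAut_bridgeAut : IsPhaseAut D.bridgeAut D.fluxFunctional :=
  isPhaseAut_conj_phase _

theorem tendsto_bridgeAut {A : Op} (hA : A ∈ weylAlgebra ⊤) :
    Tendsto (fun ε : ℝ => expA (D.cutoff ε) * A * expA (-D.cutoff ε)) (𝓝[>] 0)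
      (𝓝 (D.bridgeAut A)) := by
  have := IsPhaseAut.tendsto (fun ε : ℝ => isPhaseAut_conj_expA (D.cutoff ε))
    D.isPhaseAut_bridgeAut D.tendsto_pairing_fluxFunctional hA
  refine this.congr fun ε => ?_
  rw [Unitary.conjStarAlgAut_apply, unitaryA, star_expA]

theorem exists_isGaugeBridge : ∃ β, D.IsGaugeBridge β :=
  ⟨D.isPhaseAut_bridgeAut.restrict ⊤, fun A => D.tendsto_bridgeAut A.2.1⟩

variable {D} {β : observables ⊤ ≃⋆ₐ[ℂ] observables ⊤}

theorem IsGaugeBridge.coe_apply (hβ : D.IsGaugeBridge β) (A : observables ⊤) :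
    (β A : Op) = D.bridgeAut A :=
  tendsto_nhds_unique (hβ A) (D.tendsto_bridgeAut A.2.1)

/-- The common source of (i) and (ii). $S$ need only be constant near the charges, not supported
away from them: after the bridge has produced its phase, the uncharged state is evaluated on the
global algebra, where it is $1$ on every charge density. -/
theorem IsGaugeBridge.chargedState_fieldE (hβ : D.IsGaugeBridge β)
    {ω₀ : observables ⊤ →ₚ[ℂ] ℂ}
    (hcharge : ∀ s : ScalarTest, ω₀ (chargeDensity ⊤ s (fun _ _ => trivial)) = 1)
    {S : ScalarTest} {g : VectorTest} (hgS : g = -grad S) (hg : tsupport g ⊆ awayFrom x₁ x₂)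
    {c₁ c₂ : ℝ} (h₁ : ∀ᶠ x in 𝓝 x₁, S x = c₁) (h₂ : ∀ᶠ x in 𝓝 x₂, S x = c₂) :
    chargedState x₁ x₂ ω₀ β (fieldE (awayFrom x₁ x₂) g hg) =
      Complex.exp (Complex.I * (q * (c₁ - c₂) : ℝ)) := by
  subst hgS
  have hβE : β (toGlobal (awayFrom x₁ x₂) (fieldE (awayFrom x₁ x₂) (-grad S) hg)) =
      Complex.exp (Complex.I * D.fluxFunctional (-grad S)) •
        chargeDensity ⊤ S (fun _ _ => trivial) := by
    refine Subtype.ext ?_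
    rw [hβ.coe_apply]
    exact D.isPhaseAut_bridgeAut.map_expE (-grad S)
  change ω₀ (β (toGlobal (awayFrom x₁ x₂) (fieldE (awayFrom x₁ x₂) (-grad S) hg))) = _
  rw [hβE, map_smul, hcharge, map_neg, D.fluxFunctional_grad h₁ h₂, smul_eq_mul, mul_one]
  congr 3
  ring

/-- $W=e^{-iA(b)}$ for the closed up bridge $b$. It is a global observable and need not be localised
in $O$; on $\mathfrak A(O)$ only the phases of fields supported in $\overline O$ matter. -/
theorem IsGaugeBridge.exists_unitary (hβ : D.IsGaugeBridge β) {O : Opens E3}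
    (hOc : IsCompact (closure (O : Set E3))) (hO : closure (O : Set E3) ⊆ awayFrom x₁ x₂)
    (hnull : (ContinuousMap.inclusion hO).Nullhomotopic) :
    ∃ W : observables ⊤, star W * W = 1 ∧
      ∀ A : observables ⊤, (A : Op) ∈ observables O → β A = star W * (A * W) := by
  obtain ⟨b, hdiv, hb⟩ := D.exists_divergenceFree isClosed_closure
    (fun h => hO h (Or.inl rfl)) (fun h => hO h (Or.inr rfl))
    (transportable_of_nullhomotopic hOc hO hnull)
  have hdiv' : ∀ S, pairing (-b) (grad S) = 0 := fun S => by
    rw [pairing_neg_left, hdiv, neg_zero]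
  refine ⟨⟨expA (-b), expA_mem_observables hdiv'⟩, Subtype.ext ?_, fun A hA => Subtype.ext ?_⟩
  · change star (expA (-b)) * expA (-b) = 1
    rw [star_expA, expA_mul, neg_neg, add_neg_cancel, expA_zero]
  · change _ = star (expA (-b)) * ((A : Op) * expA (-b))
    rw [hβ.coe_apply, star_expA, neg_neg, ← mul_assoc]
    refine (D.isPhaseAut_bridgeAut.eqOn_weylAlgebra (isPhaseAut_conj_expA b) (O := O)
      (fun g hg => (hb g (hg.trans subset_closure)).symm) hA.1).trans ?_
    rw [Unitary.conjStarAlgAut_apply, unitaryA, star_expA]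

end BridgeData

theorem coe_toGlobal (O : Opens E3) (A : observables O) :
    ((toGlobal O A : observables ⊤) : Op) = A := by
  cases A
  rfl

theorem chargedState_eq_inner {x₁ x₂ : E3} {ω₀ : observables ⊤ →ₚ[ℂ] ℂ} {W : observables ⊤}
    {β : observables ⊤ ≃⋆ₐ[ℂ] observables ⊤} {A : observables (awayFrom x₁ x₂)}
    (h : β (toGlobal (awayFrom x₁ x₂) A) = star W * (toGlobal (awayFrom x₁ x₂) A * W)) :
    chargedState x₁ x₂ ω₀ β A = inner ℂ (ω₀.toPreGNS W : ω₀.GNS)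
      (ω₀.gnsStarAlgHom (toGlobal (awayFrom x₁ x₂) A) (ω₀.toPreGNS W : ω₀.GNS)) :=
  (congrArg ω₀ h).trans (inner_gnsStarAlgHom ω₀ W _).symm

namespace BridgeData

variable {x₁ x₂ : E3} {q : ℝ} {D : BridgeData x₁ x₂ q} {β : observables ⊤ ≃⋆ₐ[ℂ] observables ⊤}

theorem IsGaugeBridge.exists_vector (hβ : D.IsGaugeBridge β) {ω₀ : observables ⊤ →ₚ[ℂ] ℂ}
    (hone : ω₀ 1 = 1) {O : Opens E3} (hOc : IsCompact (closure (O : Set E3)))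
    (hO : closure (O : Set E3) ⊆ awayFrom x₁ x₂)
    (hnull : (ContinuousMap.inclusion hO).Nullhomotopic) :
    ∃ Ψ : ω₀.GNS, ‖Ψ‖ = 1 ∧
      ∀ A : observables (awayFrom x₁ x₂), (A : Op) ∈ observables O →
        chargedState x₁ x₂ ω₀ β A =
          inner ℂ Ψ (ω₀.gnsStarAlgHom (toGlobal (awayFrom x₁ x₂) A) Ψ) := by
  obtain ⟨W, hW, hβW⟩ := hβ.exists_unitary hOc hO hnull
  refine ⟨(ω₀.toPreGNS W : ω₀.GNS), norm_toPreGNS ω₀ hone hW, fun A hA => ?_⟩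
  refine chargedState_eq_inner (hβW _ ?_)
  rw [coe_toGlobal]
  exact hA

end BridgeData

end StaticCharges

end

/-! ### The theorem -/

open StaticCharges in
theorem mainTheorem3 (x₁ x₂ : E3) (q : ℝ) (D : BridgeData x₁ x₂ q)
    (ω₀ : observables ⊤ →ₚ[ℂ] ℂ) (hone : ω₀ 1 = 1)
    (hcharge : ∀ s : ScalarTest, ω₀ (chargeDensity ⊤ s (fun _ _ => trivial)) = 1) :
    (∃ β, D.IsGaugeBridge β) ∧
    ∀ β, D.IsGaugeBridge β →
      -- the bridge maps the algebra of the complement of the charges onto itself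
      (∀ A : observables ⊤,
        (A : Op) ∈ observables (awayFrom x₁ x₂) ↔ (β A : Op) ∈ observables (awayFrom x₁ x₂)) ∧
      -- `ω_X` is a state
      chargedState x₁ x₂ ω₀ β 1 = 1 ∧
      -- (i) the charge density vanishes away from the charges
      (∀ (s : ScalarTest) (hs : tsupport s ⊆ awayFrom x₁ x₂),
        chargedState x₁ x₂ ω₀ β (chargeDensity (awayFrom x₁ x₂) s hs) = 1) ∧
      -- (ii) Gauss' law
      (∀ τ : Region, τ.surface ⊆ awayFrom x₁ x₂ →
        ∃ δ > 0, ∀ s : ScalarTest, ∫ x, s x = 1 → tsupport s ⊆ Metric.ball 0 δ →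
          ∃ hg : tsupport (τ.surfaceFun s) ⊆ awayFrom x₁ x₂,
            (¬ τ.Encloses x₁ ∧ ¬ τ.Encloses x₂ →
              chargedState x₁ x₂ ω₀ β (fieldE (awayFrom x₁ x₂) (τ.surfaceFun s) hg) = 1) ∧
            (τ.Encloses x₁ ∧ τ.Encloses x₂ →
              chargedState x₁ x₂ ω₀ β (fieldE (awayFrom x₁ x₂) (τ.surfaceFun s) hg) = 1) ∧
            (τ.Encloses x₁ ∧ ¬ τ.Encloses x₂ →
              chargedState x₁ x₂ ω₀ β (fieldE (awayFrom x₁ x₂) (τ.surfaceFun s) hg) =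
                Complex.exp (Complex.I * q)) ∧
            (¬ τ.Encloses x₁ ∧ τ.Encloses x₂ →
              chargedState x₁ x₂ ω₀ β (fieldE (awayFrom x₁ x₂) (τ.surfaceFun s) hg) =
                Complex.exp (-(Complex.I * q)))) ∧
      -- (iii) restrictions to contractible regions are vector states in the GNS representation
      (∀ O : Opens E3, IsCompact (closure (O : Set E3)) →
        ∀ hO : closure (O : Set E3) ⊆ awayFrom x₁ x₂,
          (ContinuousMap.inclusion hO).Nullhomotopic →
          ∃ Ψ : ω₀.GNS, ‖Ψ‖ = 1 ∧
            ∀ A : observables (awayFrom x₁ x₂), (A : Op) ∈ observables O →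
              chargedState x₁ x₂ ω₀ β A =
                inner ℂ Ψ (ω₀.gnsStarAlgHom (toGlobal (awayFrom x₁ x₂) A) Ψ)) := by
  refine ⟨D.exists_isGaugeBridge, fun β hβ => ⟨fun A => ?_, ?_, fun s hs => ?_, fun τ hτ => ?_,
    fun O hOc hO hnull => hβ.exists_vector hone hOc hO hnull⟩⟩
  · rw [hβ.coe_apply]
    exact D.isPhaseAut_bridgeAut.mem_observables_iff
  · change ω₀ (β (toGlobal _ 1)) = 1
    rw [map_one, map_one, hone]
  -- Case (i): $s$ vanishes near both charges, so both constants are $0$.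
  · have hn : ∀ x, x ∉ awayFrom x₁ x₂ → ∀ᶠ z in 𝓝 x, s z = 0 := fun x hx =>
      notMem_tsupport_iff_eventuallyEq.1 fun h => hx (hs h)
    refine (hβ.chargedState_fieldE hcharge rfl _ (hn x₁ fun h => h (Or.inl rfl))
      (hn x₂ fun h => h (Or.inr rfl))).trans ?_
    simp
  · obtain ⟨δ₁, hδ₁, h₁⟩ := τ.eventually_potential (x := x₁) fun h => hτ h (Or.inl rfl)
    obtain ⟨δ₂, hδ₂, h₂⟩ := τ.eventually_potential (x := x₂) fun h => hτ h (Or.inr rfl)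
    refine ⟨min δ₁ δ₂, lt_min hδ₁ hδ₂, fun s hs1 hs => ?_⟩
    obtain ⟨hin₁, hout₁⟩ := h₁ s hs1 (hs.trans (Metric.ball_subset_ball (min_le_left _ _)))
    obtain ⟨hin₂, hout₂⟩ := h₂ s hs1 (hs.trans (Metric.ball_subset_ball (min_le_right _ _)))
    -- The potential is locally constant at each charge, enclosed or not, so its gradient vanishes
    -- there.
    have hg : tsupport (τ.surfaceFun s) ⊆ awayFrom x₁ x₂ := by
      rw [τ.surfaceFun_eq s]
      rintro x hx (rfl | rfl)
      · by_cases he : τ.Encloses x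
        · exact notMem_tsupport_grad (hin₁ he) hx
        · exact notMem_tsupport_grad (hout₁ he) hx
      · by_cases he : τ.Encloses x
        · exact notMem_tsupport_grad (hin₂ he) hx
        · exact notMem_tsupport_grad (hout₂ he) hx
    refine ⟨hg, fun h => ?_, fun h => ?_, fun h => ?_, fun h => ?_⟩
    · refine (hβ.chargedState_fieldE hcharge (τ.surfaceFun_eq s) hg (hout₁ h.1)
        (hout₂ h.2)).trans ?_
      simp
    · refine (hβ.chargedState_fieldE hcharge (τ.surfaceFun_eq s) hg (hin₁ h.1)
        (hin₂ h.2)).trans ?_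
      simp
    · refine (hβ.chargedState_fieldE hcharge (τ.surfaceFun_eq s) hg (hin₁ h.1)
        (hout₂ h.2)).trans ?_
      simp
    · refine (hβ.chargedState_fieldE hcharge (τ.surfaceFun_eq s) hg (hout₁ h.1)
        (hin₂ h.2)).trans ?_
      simp
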